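/- Let $(\mathbb{B},\|\cdot\|)$ be a separable real Banach space that is $r$-smooth for some $r\in(1,2]$, i.e. there is an equivalent norm $\|\cdot\|'$ on $\mathbb{B}$ with $$\sup_{\tau>0}\ \sup_{\|x\|'=\|y\|'=1}\frac{\|x+\tau y\|'+\|x-\tau y\|'-2}{\tau^{r}}<\infty .$$ Let $m\ge 1$ be an integer, $p\in(1,r]$ and $q>0$. Then there is a finite constant $K=K(m,p,q,\mathbb{B})$, depending only on $m,p,q$ and $\mathbb{B}$, such that the following holds. Let $(\xi_i)_{i\ge1}$ be an i.i.d. sequence with values in a measurable space $(S,\mathcal{S})$. Write $[m]=\{1,\dots,m\}$, $\xi_J=(\xi_j)_{j\in J}$ for $J\subseteq[m]$, $\operatorname{Inc}^m=\{\mathbf{i}=(i_1,\dots,i_m)\in\mathbb{N}^m: 1\le i_1<\dots<i_m\}$, $\operatorname{Inc}^m_n=\{\mathbf{i}\in\operatorname{Inc}^m: i_m\le n\}$ and $\xi_{\mathbf{i}}=(\xi_{i_1},\dots,\xi_{i_m})$. For each $\mathbf{i}\in\operatorname{Inc}^m$ let $h_{\mathbf{i}}\colon S^m\to\mathbb{B}$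 be a measurable function that is degenerated with respect to $(\xi_i)$, i.e. $h_{\mathbf{i}}(\xi_{[m]})$ is integrable and $\mathbb{E}[h_{\mathbf{i}}(\xi_{[m]})\mid\xi_{[m]\setminus\{\ell_0\}}]=0$ almost surely for every $\ell_0\in[m]$. Then for every integer $N\ge m$ and every $t>0$, $$\begin{aligned} \mathbb{P}\Big(\max_{m\le n\le N}\Big\|\sum_{\mathbf{i}\in\operatorname{Inc}^m_n}h_{\mathbf{i}}(\xi_{\mathbf{i}})\Big\|>t\Big) \le{}& K\sum_{\mathbf{i}\in\operatorname{Inc}^m_N}\int_0^1u^{q-1}\,\mathbb{P}\big(\|h_{\mathbf{i}}(\xi_{[m]})\|>tu\big)\,du\\ &+K\sum_{\emptyset\subsetneq J\subsetneq[m]}\ \sum_{\mathbf{a}\in\mathbb{N}^J}\int_0^1u^{q-1}\,\mathbb{P}\Big(\Big(\sum_{\substack{\mathbf{i}\in\operatorname{Inc}^m_N\\ i_j=a_j\ \forall j\in J}}\mathbb{E}\big[\|h_{\mathbf{i}}(\xi_{[m]})\|^p\mid\xi_J\big]\Big)^{1/p}>tu\Big)\,du\\ &+K\,t^{-q}\Big(\sum_{\mathbf{i}\in\operatorname{Inc}^m_N}\mathbb{E}\|h_{\mathbf{i}}(\xi_{[m]})\|^p\Big)^{q/p},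 \end{aligned}$$ where the right-hand side may be $+\infty$. -/

import Mathlib

open MeasureTheory ProbabilityTheory
open scoped ENNReal NNReal

universe u v w

namespace UStat

/-- `B` is `r`-smooth: some equivalent norm `ν` on `B` satisfies
`sup_{τ > 0} sup_{ν x = ν y = 1} (ν (x + τ y) + ν (x - τ y) - 2) / τ ^ r < ∞`.
A seminorm that is bounded below by a positive multiple of the norm is a norm. -/
def IsSmoothSpace (r : ℝ) (B : Type*) [NormedAddCommGroup B] [NormedSpace ℝ B] : Prop :=
  ∃ ν : Seminorm ℝ B,
    (∃ c C : ℝ, 0 < c ∧ 0 < C ∧ ∀ x : B, c * ‖x‖ ≤ ν x ∧ ν x ≤ C * ‖x‖) ∧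
    ∃ L : ℝ, ∀ τ : ℝ, 0 < τ → ∀ x y : B, ν x = 1 → ν y = 1 →
      (ν (x + τ • y) + ν (x - τ • y) - 2) / τ ^ r ≤ L

/-- The set `Inc_n^m` of strictly increasing `m`-tuples of indices. Indices are counted from `0`
instead of `1`, so that they range over `{0, …, n - 1}`. -/
noncomputable def inc (m n : ℕ) : Finset (Fin m → ℕ) :=
  open Classical in (Fintype.piFinset fun _ : Fin m => Finset.range n).filter StrictMono

/-- The random vector of the first `m` terms of the sequence `ξ`. -/
def firstTerms {Ω S : Type*} (m : ℕ) (ξ : ℕ → Ω → S) : Ω → Fin m → S :=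
  fun ω ℓ => ξ ℓ ω

/-- The `σ`-algebra generated by `ξ_J`, the coordinates in `J` of the first `m` terms. -/
abbrev sigmaAlg {Ω S : Type*} [MeasurableSpace S] {m : ℕ} (ξ : ℕ → Ω → S) (J : Finset (Fin m)) :
    MeasurableSpace Ω :=
  MeasurableSpace.comap (fun ω (j : J) => firstTerms m ξ ω j) inferInstance

/-- Independent and identically distributed sequence of random variables. -/
structure IsIID {Ω S : Type*} [MeasurableSpace Ω] [MeasurableSpace S] (ξ : ℕ → Ω → S)
    (P : Measure Ω) : Prop where
  measurable : ∀ i, Measurable (ξ i)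
  indep : iIndepFun ξ P
  identDistrib : ∀ i, IdentDistrib (ξ i) (ξ 0) P P

/-- The kernel `g : S^m → B` is degenerated with respect to `ξ`: the conditional expectation of
`g(ξ_{1,…,m})` given all coordinates but one exists and vanishes, whichever coordinate is left
out. Integrability is part of the notion, for the conditional expectation to make sense. -/
structure IsDegenerate {Ω S B : Type*} [MeasurableSpace Ω] [MeasurableSpace S]
    [NormedAddCommGroup B] [NormedSpace ℝ B] [CompleteSpace B] {m : ℕ}
    (g : (Fin m → S) → B) (ξ : ℕ → Ω → S) (P : Measure Ω) : Prop where
  integrable : Integrable (fun ω => g (firstTerms m ξ ω)) P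
  condExp_eq_zero : ∀ ℓ₀ : Fin m,
    P[fun ω => g (firstTerms m ξ ω) | sigmaAlg ξ (Finset.univ.erase ℓ₀)] =ᵐ[P] 0

/-- The `U`-statistic `∑_{i ∈ Inc_n^m} h_i(ξ_i)`, where `ξ_i = (ξ_{i_1}, …, ξ_{i_m})`. -/
noncomputable def uStat {Ω S B : Type*} [NormedAddCommGroup B] {m : ℕ}
    (h : (Fin m → ℕ) → (Fin m → S) → B) (ξ : ℕ → Ω → S) (n : ℕ) (ω : Ω) : B :=
  ∑ i ∈ inc m n, h i (fun ℓ => ξ (i ℓ) ω)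

/-- `∫_0^1 u^{q-1} P(Y > t u) du` for a `[0, ∞]`-valued random variable `Y`. -/
noncomputable def tailIntegral {Ω : Type*} [MeasurableSpace Ω] (P : Measure Ω) (q t : ℝ)
    (Y : Ω → ℝ≥0∞) : ℝ≥0∞ :=
  ∫⁻ u in Set.Ioo (0 : ℝ) 1, ENNReal.ofReal (u ^ (q - 1)) * P {ω | ENNReal.ofReal (t * u) < Y ω}

/-- The `p`-th root of the sum of `E[‖h_i(ξ_{1,…,m})‖^p | ξ_J]` over all `i ∈ Inc_N^m` whose
coordinates in `J` are given by `a`. -/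
noncomputable def condMomentRoot {Ω S B : Type*} [MeasurableSpace Ω] [MeasurableSpace S]
    [NormedAddCommGroup B] {m : ℕ} (P : Measure Ω) (h : (Fin m → ℕ) → (Fin m → S) → B)
    (ξ : ℕ → Ω → S) (p : ℝ) (N : ℕ) (J : Finset (Fin m)) (a : J → ℕ) (ω : Ω) : ℝ≥0∞ :=
  (∑ i ∈ inc m N with ∀ j : J, i j = a j,
    condLExp (sigmaAlg ξ J) P (fun ω' => ‖h i (firstTerms m ξ ω')‖ₑ ^ p) ω) ^ (1 / p)

end UStat

namespace UStat

/-! ### Smooth norms -/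

/-! The proof is an induction on the order `m`, driven by a Burkholder-type good-λ inequality for
martingales. Both sides of the claim are first expressed by truncated moments `E min(1, W)^κ` with
`κ = q / p`, where `W` is a `p`-th power of a norm divided by `t ^ p`. By the layer-cake formula
(`lintegral_trunc`) these are the tail integrals up to the factor `q`. They never exceed `1`, so
terms can be absorbed without any moment assumption.

Smoothness yields a two-point inequality of power type `p` for an equivalent norm. Integrated, and
combined with Jensen's inequality for a centred increment, it gives the `p`-th moment bound for
martingale sums (`lintegral_enorm_sum_rpow_le`). Everything is done with an additional parameter `y`
from a measure space `(Y, ν)`, that is, for martingales with values in `L^p(ν; B)`; the induction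
needs this generality. Stopping between two crossings then gives the good-λ inequality
`measure_lt_maxSum_le`, and its integrated form bounds the maximum by the increments and the
predictable `p`-variation (`exists_lintegral_trunc_maxSum_le`).

A degenerate sum of order `m + 1` is a martingale in its largest index, and both quantities in this
bound have order `m`. For a fixed value of the coordinate `n`, the increment at `n` is a degenerate
sum of order `m` (`freeze`). The predictable variation is the `p`-th power of the norm, in `L^p`
over counting measure times `ν` times an independent copy, of a degenerate sum of order `m`
(`resample`). The conditional moments of both new families are dominated by those of the original
one (`condVar_freeze_le`, `condVar_resample_le`), so the induction closes in
`exists_lintegral_trunc_maxStat_le`.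

The result is a sum over sets `A` of indices on which one conditions. Recording which positions of
an increasing tuple fall into `A`, and with which values, turns it into a sum over pairs `(J, a)`.
The set of all positions, the proper nonempty sets and the empty set give the three terms of the
theorem. -/

/-- Bernoulli's inequality for the concave power `p - 1`, multiplied by `1 + s`; the quadratic
remainder `(p - 1) s²` is at most `s²`. -/
theorem one_add_rpow_le {p s : ℝ} (hp1 : 1 < p) (hp2 : p ≤ 2) (hs : -1 ≤ s) :
    (1 + s) ^ p ≤ 1 + p * s + s ^ 2 := by
  have h0 : 0 ≤ 1 + s := by linarith
  have h1 : (1 + s) ^ (p - 1) ≤ 1 + (p - 1) * s :=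
    rpow_one_add_le_one_add_mul_self hs (by linarith) (by linarith)
  have h2 : (1 + s) ^ p = (1 + s) ^ (p - 1) * (1 + s) := by
    rw [← Real.rpow_add_one' h0 (by linarith)]; ring_nf
  rw [h2]
  nlinarith [mul_le_mul_of_nonneg_right h1 h0, sq_nonneg s]

/-- For `τ ≤ 1` the linear parts of the expansions at `1` add up to `p (a + b - 2)`, which
smoothness controls, and the quadratic parts are at most `τ² ≤ τ ^ p`. For `τ > 1` the crude bound
`a, b ≤ 2 τ` suffices and accounts for the constant `8`. -/
theorem rpow_add_rpow_le_of_add_le {p a b τ L : ℝ} (hp1 : 1 < p) (hp2 : p ≤ 2) (hτ : 0 < τ)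
    (ha0 : 0 ≤ a) (hb0 : 0 ≤ b) (ha : |a - 1| ≤ τ) (hb : |b - 1| ≤ τ) (hL : 0 ≤ L)
    (hab : τ ≤ 1 → a + b - 2 ≤ L * τ ^ p) :
    a ^ p + b ^ p ≤ 2 + (2 * L + 8) * τ ^ p := by
  have hτp : 0 ≤ τ ^ p := by positivity
  rw [abs_le] at ha hb
  rcases le_or_gt τ 1 with h1 | h1
  · have h2 : τ ^ (2 : ℝ) ≤ τ ^ p := Real.rpow_le_rpow_of_exponent_ge hτ h1 hp2
    rw [Real.rpow_two] at h2
    have ea := one_add_rpow_le hp1 hp2 (s := a - 1) (by linarith)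
    have eb := one_add_rpow_le hp1 hp2 (s := b - 1) (by linarith)
    rw [add_sub_cancel] at ea eb
    have sa : (a - 1) ^ 2 ≤ τ ^ 2 := by nlinarith
    have sb : (b - 1) ^ 2 ≤ τ ^ 2 := by nlinarith
    have := hab h1
    have h3 : p * (a + b - 2) ≤ p * (L * τ ^ p) := by gcongr
    have h4 : p * (L * τ ^ p) ≤ 2 * (L * τ ^ p) := by gcongr
    nlinarith
  · have h2 : (2 : ℝ) ^ p ≤ 4 := by
      calc (2 : ℝ) ^ p ≤ 2 ^ (2 : ℝ) := Real.rpow_le_rpow_of_exponent_le (by norm_num) hp2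
        _ = 4 := by norm_num
    have h3 : (2 * τ) ^ p ≤ 4 * τ ^ p := by
      rw [Real.mul_rpow (by norm_num) hτ.le]; gcongr
    have ea : a ^ p ≤ (2 * τ) ^ p := by gcongr; linarith
    have eb : b ^ p ≤ (2 * τ) ^ p := by gcongr; linarith
    nlinarith [mul_nonneg hL hτp]

/-- The seminorm `ψ` is an equivalent norm that satisfies a two-point inequality of power
type `p`, all constants being bounded by `C`. -/
structure IsTwoPointNorm {B : Type*} [NormedAddCommGroup B] [NormedSpace ℝ B] (p : ℝ)
    (ψ : Seminorm ℝ B) (C : ℝ≥0) : Prop where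
  norm_le : ∀ x, ‖x‖ ≤ C * ψ x
  le_norm : ∀ x, ψ x ≤ C * ‖x‖
  two_point : ∀ x y, ψ (x + y) ^ p + ψ (x - y) ^ p ≤ 2 * ψ x ^ p + C * ψ y ^ p

/-- A smooth space carries an equivalent norm which satisfies a two-point inequality of
power type `p`. -/
theorem IsSmoothSpace.exists_two_point {B : Type*} [NormedAddCommGroup B] [NormedSpace ℝ B]
    {r p : ℝ} (hr : r ≤ 2) (hB : IsSmoothSpace r B) (hp : p ∈ Set.Ioc 1 r) :
    ∃ (ψ : Seminorm ℝ B) (C : ℝ≥0), IsTwoPointNorm p ψ C := by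
  obtain ⟨ψ, ⟨c, C, hc, hC, hcC⟩, L, hL⟩ := hB
  obtain ⟨hp1, hpr⟩ := hp
  set M : ℝ := 2 * max L 0 + 8 with hM
  have hMpos : 0 ≤ M := by positivity
  have key : ∀ x y, ψ (x + y) ^ p + ψ (x - y) ^ p ≤ 2 * ψ x ^ p + M * ψ y ^ p := by
    intro x y
    have hM8 : 8 ≤ M := by rw [hM]; linarith [le_max_right L 0]
    rcases (apply_nonneg ψ x).eq_or_lt with hx | hx
    · have hx0 : x = 0 := by
        have := (hcC x).1
        rw [← hx] at this
        exact norm_eq_zero.1 (le_antisymm (by nlinarith) (norm_nonneg x))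
      subst hx0
      have : 0 ≤ ψ y ^ p := by positivity
      simp only [zero_add, zero_sub, map_neg_eq_map, map_zero]
      rw [Real.zero_rpow (by linarith)]
      nlinarith
    rcases (apply_nonneg ψ y).eq_or_lt with hy | hy
    · have hy0 : y = 0 := by
        have := (hcC y).1
        rw [← hy] at this
        exact norm_eq_zero.1 (le_antisymm (by nlinarith) (norm_nonneg y))
      subst hy0
      simp only [add_zero, sub_zero, map_zero]
      rw [Real.zero_rpow (by linarith)]
      linarith
    -- By homogeneity the factor `ψ x` can be taken out, which leaves unit vectors `x'`, `y'` and
    -- the step size `τ`.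
    set τ := ψ y / ψ x with hτ
    have hτ0 : 0 < τ := by positivity
    set x' := (ψ x)⁻¹ • x with hx'
    set y' := (ψ y)⁻¹ • y with hy'
    have ex : ψ x' = 1 := by
      rw [hx', map_smul_eq_mul, Real.norm_of_nonneg (by positivity)]; field_simp
    have ey : ψ y' = 1 := by
      rw [hy', map_smul_eq_mul, Real.norm_of_nonneg (by positivity)]; field_simp
    have e1 : x + y = ψ x • (x' + τ • y') := by
      rw [hx', hy', smul_add, smul_smul, smul_smul, smul_smul, hτ,
        mul_inv_cancel₀ hx.ne', one_smul]
      congr 1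
      rw [show ψ x * (ψ y / ψ x) * (ψ y)⁻¹ = 1 by field_simp, one_smul]
    have e2 : x - y = ψ x • (x' - τ • y') := by
      rw [hx', hy', smul_sub, smul_smul, smul_smul, smul_smul, hτ,
        mul_inv_cancel₀ hx.ne', one_smul]
      congr 1
      rw [show ψ x * (ψ y / ψ x) * (ψ y)⁻¹ = 1 by field_simp, one_smul]
    have eτ : ψ (τ • y') = τ := by
      rw [map_smul_eq_mul, ey, mul_one, Real.norm_of_nonneg hτ0.le]
    have ha : |ψ (x' + τ • y') - 1| ≤ τ := by
      rw [abs_le]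
      have h1 := map_add_le_add ψ x' (τ • y')
      have h2 := map_sub_le_add ψ (x' + τ • y') (τ • y')
      rw [add_sub_cancel_right] at h2
      constructor <;> linarith
    have hb : |ψ (x' - τ • y') - 1| ≤ τ := by
      rw [abs_le]
      have h1 := map_sub_le_add ψ x' (τ • y')
      have h2 := map_add_le_add ψ (x' - τ • y') (τ • y')
      rw [sub_add_cancel] at h2
      constructor <;> linarith
    have hab : τ ≤ 1 → ψ (x' + τ • y') + ψ (x' - τ • y') - 2 ≤ max L 0 * τ ^ p := by
      intro h1
      have h2 := hL τ hτ0 x' y' ex ey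
      rw [div_le_iff₀ (by positivity)] at h2
      refine h2.trans ?_
      have h3 : τ ^ r ≤ τ ^ p := Real.rpow_le_rpow_of_exponent_ge hτ0 h1 hpr
      have h4 : 0 ≤ τ ^ r := by positivity
      calc L * τ ^ r ≤ max L 0 * τ ^ r := by gcongr; exact le_max_left _ _
        _ ≤ _ := by gcongr
    have main := rpow_add_rpow_le_of_add_le hp1 (hpr.trans hr) hτ0 (apply_nonneg ψ _)
      (apply_nonneg ψ _) ha hb (le_max_right L 0) hab
    rw [e1, e2, map_smul_eq_mul, map_smul_eq_mul, Real.norm_of_nonneg hx.le,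
      Real.mul_rpow hx.le (apply_nonneg ψ _), Real.mul_rpow hx.le (apply_nonneg ψ _), ← mul_add]
    have e3 : ψ y ^ p = ψ x ^ p * τ ^ p := by
      rw [← Real.mul_rpow hx.le hτ0.le, hτ, mul_div_cancel₀ _ hx.ne']
    rw [e3]
    have : 0 ≤ ψ x ^ p := by positivity
    nlinarith [mul_le_mul_of_nonneg_left main this]
  refine ⟨ψ, (max (max c⁻¹ C) M).toNNReal, fun x => ?_, fun x => ?_, fun x y => ?_⟩
  all_goals rw [Real.coe_toNNReal _ (by positivity)]
  · have h1 : ‖x‖ ≤ c⁻¹ * ψ x := by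
      rw [inv_mul_eq_div, le_div_iff₀ hc, mul_comm]; exact (hcC x).1
    refine h1.trans ?_
    gcongr
    exact (le_max_left _ _).trans (le_max_left _ _)
  · refine (hcC x).2.trans ?_
    gcongr
    exact (le_max_right _ _).trans (le_max_left _ _)
  · refine (key x y).trans ?_
    gcongr
    exact le_max_right _ _

theorem continuous_of_le_mul_norm {B : Type*} [NormedAddCommGroup B] [NormedSpace ℝ B]
    (ψ : Seminorm ℝ B) {C : ℝ≥0} (hC : ∀ x, ψ x ≤ C * ‖x‖) : Continuous ψ := by
  refine Seminorm.continuous_of_le (q := C • normSeminorm ℝ B) ?_ (fun x => ?_)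
  · change Continuous fun x : B => (C : ℝ) * ‖x‖
    fun_prop
  · exact hC x

/-- Jensen's inequality for the power of a seminorm and a centred perturbation. -/
theorem ofReal_seminorm_rpow_le_lintegral {B Ω : Type*} [NormedAddCommGroup B] [NormedSpace ℝ B]
    [CompleteSpace B] [MeasurableSpace Ω] {P : Measure Ω} [IsProbabilityMeasure P]
    (ψ : Seminorm ℝ B) {C : ℝ≥0} (hC : ∀ x, ψ x ≤ C * ‖x‖) {p : ℝ} (hp : 1 ≤ p)
    {g : Ω → B} (hg : Integrable g P) (hg0 : ∫ ω, g ω ∂P = 0) (a : B) :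
    ENNReal.ofReal (ψ a ^ p) ≤ ∫⁻ ω, ENNReal.ofReal (ψ (a - g ω) ^ p) ∂P := by
  have hψ := continuous_of_le_mul_norm ψ hC
  have hcont : Continuous fun x => ψ x ^ p := hψ.rpow_const fun x => Or.inr (by linarith)
  have hag : Integrable (fun ω => a - g ω) P := (integrable_const a).sub hg
  by_cases htop : ∫⁻ ω, ENNReal.ofReal (ψ (a - g ω) ^ p) ∂P = ∞
  · rw [htop]; exact le_top
  have h_int : Integrable (fun ω => ψ (a - g ω) ^ p) P := by
    refine ⟨hcont.comp_aestronglyMeasurable hag.1, ?_⟩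
    rw [hasFiniteIntegral_iff_ofReal (Filter.Eventually.of_forall fun ω => by positivity)]
    exact lt_top_iff_ne_top.2 htop
  have hconv : ConvexOn ℝ Set.univ fun x => ψ x ^ p := by
    refine ⟨convex_univ, fun x _ y _ a b ha hb hab => ?_⟩
    have h1 : ψ (a • x + b • y) ≤ a • ψ x + b • ψ y :=
      ψ.convexOn.2 (Set.mem_univ x) (Set.mem_univ y) ha hb hab
    exact (Real.rpow_le_rpow (apply_nonneg ψ _) h1 (by linarith)).trans
      ((convexOn_rpow hp).2 (apply_nonneg ψ x) (apply_nonneg ψ y) ha hb hab)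
  have h1 := hconv.map_integral_le hcont.continuousOn isClosed_univ
    (Filter.Eventually.of_forall fun _ => Set.mem_univ _) hag h_int
  rw [integral_sub (integrable_const a) hg, hg0, sub_zero, integral_const, probReal_univ,
    one_smul] at h1
  rw [← ofReal_integral_eq_lintegral_ofReal h_int
    (Filter.Eventually.of_forall fun ω => by positivity)]
  exact ENNReal.ofReal_le_ofReal h1

/-! ### Truncated powers and tail integrals -/

/-- The truncated power `min(1, w) ^ κ`. -/
noncomputable def trunc (κ : ℝ) (w : ℝ≥0∞) : ℝ≥0∞ := (min 1 w) ^ κ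

section trunc

variable {κ : ℝ}

theorem trunc_le_one (hκ : 0 < κ) (w : ℝ≥0∞) : trunc κ w ≤ 1 :=
  ENNReal.rpow_le_one (min_le_left _ _) hκ.le

theorem trunc_of_one_le {w : ℝ≥0∞} (hw : 1 ≤ w) : trunc κ w = 1 := by
  rw [trunc, min_eq_left hw, ENNReal.one_rpow]

theorem trunc_zero (hκ : 0 < κ) : trunc κ 0 = 0 := by
  rw [trunc, min_eq_right zero_le_one, ENNReal.zero_rpow_of_pos hκ]

theorem trunc_mono (hκ : 0 < κ) : Monotone (trunc κ) := fun _ _ h =>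
  ENNReal.rpow_le_rpow (min_le_min_left _ h) hκ.le

theorem trunc_le_rpow (hκ : 0 < κ) (w : ℝ≥0∞) : trunc κ w ≤ w ^ κ :=
  ENNReal.rpow_le_rpow (min_le_right _ _) hκ.le

@[fun_prop]
theorem measurable_trunc {Z : Type*} [MeasurableSpace Z] {f : Z → ℝ≥0∞} (hf : Measurable f) :
    Measurable fun z => trunc κ (f z) :=
  (measurable_const.min hf).pow_const κ

/-- This replaces homogeneity: enlarging the argument by `c` costs at most the factor `c ^ κ`. -/
theorem trunc_mul_le (hκ : 0 < κ) {c : ℝ≥0∞} (hc : 1 ≤ c) (w : ℝ≥0∞) :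
    trunc κ (c * w) ≤ c ^ κ * trunc κ w := by
  rw [trunc, trunc, ← ENNReal.mul_rpow_of_nonneg _ _ hκ.le]
  refine ENNReal.rpow_le_rpow ?_ hκ.le
  rcases le_total 1 w with h | h
  · rw [min_eq_left h, mul_one]; exact (min_le_left _ _).trans hc
  · rw [min_eq_right h]; exact min_le_right _ _

/-- The sum is at most the number of terms times the largest one, which treats `κ ≤ 1` and `κ > 1`
alike. -/
theorem trunc_sum_le {ι : Type*} (hκ : 0 < κ) (s : Finset ι) (w : ι → ℝ≥0∞) :
    trunc κ (∑ i ∈ s, w i) ≤ (s.card : ℝ≥0∞) ^ κ * ∑ i ∈ s, trunc κ (w i) := by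
  rcases s.eq_empty_or_nonempty with rfl | hs
  · simp [trunc_zero hκ]
  obtain ⟨j, hj, hmax⟩ := s.exists_max_image w hs
  have hc : (1 : ℝ≥0∞) ≤ s.card := by exact_mod_cast hs.card_pos
  calc trunc κ (∑ i ∈ s, w i) ≤ trunc κ (s.card * w j) := by
        refine trunc_mono hκ ?_
        rw [← nsmul_eq_mul]
        exact Finset.sum_le_card_nsmul _ _ _ hmax
    _ ≤ (s.card : ℝ≥0∞) ^ κ * trunc κ (w j) := trunc_mul_le hκ hc _
    _ ≤ _ := by
        gcongr
        exact Finset.single_le_sum (f := fun i => trunc κ (w i)) (fun _ _ => zero_le) hj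

theorem trunc_rpow {p : ℝ} (hp : 0 < p) (w : ℝ≥0∞) : trunc κ (w ^ p) = trunc (p * κ) w := by
  rw [trunc, trunc, ENNReal.rpow_mul]
  congr 1
  rcases le_total 1 w with h | h
  · rw [min_eq_left h, min_eq_left (ENNReal.one_le_rpow h hp), ENNReal.one_rpow]
  · rw [min_eq_right h, min_eq_right (ENNReal.rpow_le_one h hp.le)]

end trunc

/-- Layer-cake formula for `min(1, Y / t)`; the cap at `1` ends the integration at `u = 1`. -/
theorem lintegral_trunc {Ω : Type*} [MeasurableSpace Ω] (P : Measure Ω) {q t : ℝ} (hq : 0 < q)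
    (ht : 0 < t) {Y : Ω → ℝ≥0∞} (hY : AEMeasurable Y P) :
    ∫⁻ ω, trunc q (Y ω / ENNReal.ofReal t) ∂P = ENNReal.ofReal q * tailIntegral P q t Y := by
  set f : Ω → ℝ := fun ω => (min 1 (Y ω / ENNReal.ofReal t)).toReal with hf
  have hfin : ∀ ω, min 1 (Y ω / ENNReal.ofReal t) ≠ ∞ := fun ω =>
    ne_top_of_le_ne_top ENNReal.one_ne_top (min_le_left _ _)
  have hfm : AEMeasurable f P :=
    (aemeasurable_const.min (hY.div_const _)).ennreal_toReal
  have h1 := lintegral_rpow_eq_lintegral_meas_lt_mul P (f := f)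
    (Filter.Eventually.of_forall fun ω => ENNReal.toReal_nonneg) hfm hq
  have h2 : ∀ ω, ENNReal.ofReal (f ω ^ q) = trunc q (Y ω / ENNReal.ofReal t) := by
    intro ω
    rw [← ENNReal.ofReal_rpow_of_nonneg ENNReal.toReal_nonneg hq.le,
      ENNReal.ofReal_toReal (hfin ω), trunc]
  simp_rw [h2] at h1
  rw [h1, tailIntegral]
  congr 1
  have hset : ∀ u : ℝ, 0 < u → {ω | u < f ω} =
      {ω | u < 1 ∧ ENNReal.ofReal (t * u) < Y ω} := by
    intro u hu
    ext ω
    simp only [Set.mem_ofPred_eq, hf]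
    rw [← ENNReal.ofReal_lt_iff_lt_toReal hu.le (hfin ω), lt_min_iff, ENNReal.ofReal_lt_one,
      ENNReal.lt_div_iff_mul_lt (Or.inl (by simpa using ht)) (Or.inl ENNReal.ofReal_ne_top),
      ← ENNReal.ofReal_mul hu.le, mul_comm u t]
  rw [← lintegral_indicator measurableSet_Ioi, ← lintegral_indicator measurableSet_Ioo]
  refine lintegral_congr fun u => ?_
  by_cases hu : 0 < u
  · by_cases hu1 : u < 1
    · rw [Set.indicator_of_mem (Set.mem_Ioi.2 hu), Set.indicator_of_mem (Set.mem_Ioo.2 ⟨hu, hu1⟩),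
        hset u hu, mul_comm]
      simp [hu1]
    · rw [Set.indicator_of_mem (Set.mem_Ioi.2 hu), Set.indicator_of_notMem (by simp [hu1]),
        hset u hu]
      simp [hu1]
  · rw [Set.indicator_of_notMem (by simpa using hu), Set.indicator_of_notMem (by simp [hu])]

/-! ### Resampling coordinates of product measures -/

/-- The common law of a family of independent variables with law `μ`. -/
noncomputable abbrev iidLaw (ι : Type*) {S : Type*} [MeasurableSpace S] (μ : Measure S) :
    Measure (ι → S) :=
  Measure.infinitePi fun _ : ι => μ

open Classical in
/-- The family with the coordinates of `x` on `A` and those of `w` off `A`. -/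
noncomputable def splice {ι S : Type*} (A : Set ι) (x w : ι → S) : ι → S :=
  fun i => if i ∈ A then x i else w i

section splice

variable {ι S : Type*} {A : Set ι} {x w : ι → S} {i : ι}

theorem splice_of_mem (h : i ∈ A) : splice A x w i = x i := if_pos h

theorem splice_of_notMem (h : i ∉ A) : splice A x w i = w i := if_neg h

theorem splice_compl_singleton_of_ne {k : ι} (h : i ≠ k) : splice {k}ᶜ x w i = x i :=
  splice_of_mem (by simpa using h)

theorem splice_compl_singleton_self {k : ι} : splice {k}ᶜ x w k = w k :=
  splice_of_notMem (by simp)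

theorem splice_compl_singleton_comm {k n : ι} (h : k ≠ n) (x w w' : ι → S) :
    splice {n}ᶜ (splice {k}ᶜ x w') w = splice {k}ᶜ (splice {n}ᶜ x w) w' := by
  funext i
  by_cases h1 : i = n
  · subst h1
    rw [splice_compl_singleton_self, splice_compl_singleton_of_ne h.symm,
      splice_compl_singleton_self]
  · rw [splice_compl_singleton_of_ne h1]
    by_cases h2 : i = k
    · subst h2; rw [splice_compl_singleton_self, splice_compl_singleton_self]
    · rw [splice_compl_singleton_of_ne h2, splice_compl_singleton_of_ne h2,
        splice_compl_singleton_of_ne h1]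

theorem splice_empty (x w : ι → S) : splice ∅ x w = w :=
  funext fun i => splice_of_notMem (by simp)

variable [MeasurableSpace S]

@[fun_prop]
theorem measurable_splice {Z : Type*} [MeasurableSpace Z] (A : Set ι) {f g : Z → ι → S}
    (hf : Measurable f) (hg : Measurable g) : Measurable fun z => splice A (f z) (g z) := by
  refine measurable_pi_iff.2 fun i => ?_
  by_cases h : i ∈ A
  · simp only [splice_of_mem h]; fun_prop
  · simp only [splice_of_notMem h]; fun_prop

/-- The preimage of a cylinder over `s` is the product of a cylinder over `s ∩ A` and one over `s \
A`, and their measures multiply to that of the original cylinder. -/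
theorem measurePreserving_splice (μ : Measure S) [IsProbabilityMeasure μ] (A : Set ι) :
    MeasurePreserving (fun z : (ι → S) × (ι → S) => splice A z.1 z.2)
      ((iidLaw ι μ).prod (iidLaw ι μ)) (iidLaw ι μ) := by
  classical
  have hm : Measurable fun z : (ι → S) × (ι → S) => splice A z.1 z.2 := by fun_prop
  refine ⟨hm, Measure.eq_infinitePi _ fun s t ht => ?_⟩
  have hpre : (fun z : (ι → S) × (ι → S) => splice A z.1 z.2) ⁻¹' (Set.pi s t) =
      (Set.pi (s.filter (· ∈ A)) t) ×ˢ (Set.pi (s.filter (· ∉ A)) t) := by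
    ext z
    simp only [Set.mem_preimage, Set.mem_pi, Set.mem_prod, Finset.mem_coe, Finset.mem_filter]
    constructor
    · intro h
      refine ⟨fun i hi => ?_, fun i hi => ?_⟩
      · have := h i hi.1; rwa [splice_of_mem hi.2] at this
      · have := h i hi.1; rwa [splice_of_notMem hi.2] at this
    · rintro ⟨h1, h2⟩ i hi
      by_cases hA : i ∈ A
      · rw [splice_of_mem hA]; exact h1 i ⟨hi, hA⟩
      · rw [splice_of_notMem hA]; exact h2 i ⟨hi, hA⟩
  rw [Measure.map_apply hm (MeasurableSet.pi (Finset.countable_toSet s) fun i _ => ht i), hpre,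
    Measure.prod_prod, Measure.infinitePi_pi _ fun i _ => ht i,
    Measure.infinitePi_pi _ fun i _ => ht i, Finset.prod_filter_mul_prod_filter_not]

/-- The inner integral plays the role of the conditional expectation given the coordinates in `A`;
this is its tower property. -/
theorem lintegral_splice (μ : Measure S) [IsProbabilityMeasure μ] (A : Set ι)
    {F : (ι → S) → ℝ≥0∞} (hF : Measurable F) :
    ∫⁻ x, ∫⁻ w, F (splice A x w) ∂iidLaw ι μ ∂iidLaw ι μ = ∫⁻ x, F x ∂iidLaw ι μ := by
  rw [← (measurePreserving_splice μ A).lintegral_comp hF, lintegral_prod _ (by fun_prop)]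

theorem lintegral_splice_prod (μ : Measure S) [IsProbabilityMeasure μ] (A : Set ι)
    {Y : Type*} [MeasurableSpace Y] (ν : Measure Y) [SFinite ν]
    {F : (ι → S) × Y → ℝ≥0∞} (hF : Measurable F) :
    ∫⁻ z, ∫⁻ w, F (splice A z.1 w, z.2) ∂iidLaw ι μ ∂(iidLaw ι μ).prod ν =
      ∫⁻ z, F z ∂(iidLaw ι μ).prod ν := by
  have h1 : Measurable fun z : (ι → S) × Y => ∫⁻ w, F (splice A z.1 w, z.2) ∂iidLaw ι μ :=
    Measurable.lintegral_prod_right' (f := fun z : ((ι → S) × Y) × (ι → S) =>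
      F (splice A z.1.1 z.2, z.1.2)) (by fun_prop)
  rw [lintegral_prod_symm _ h1.aemeasurable, lintegral_prod_symm _ hF.aemeasurable]
  refine lintegral_congr fun y => ?_
  exact lintegral_splice μ A (F := fun x => F (x, y)) (by fun_prop)

/-- Properties that hold almost surely persist when some coordinates are resampled. -/
theorem ae_splice_prod (μ : Measure S) [IsProbabilityMeasure μ] (A : Set ι)
    {Y : Type*} [MeasurableSpace Y] (ν : Measure Y) [SFinite ν] {Q : (ι → S) × Y → Prop}
    (hQ : ∀ᵐ z ∂(iidLaw ι μ).prod ν, Q z) :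
    ∀ᵐ z ∂((iidLaw ι μ).prod (iidLaw ι μ)).prod ν, Q (splice A z.1.1 z.1.2, z.2) :=
  ((measurePreserving_splice μ A).prod (MeasurePreserving.id ν)).quasiMeasurePreserving.ae hQ

end splice

/-- Serves to freeze the independent copy in `X₂`: it becomes the outermost variable. -/
theorem ae_rearrange_left {X₁ X₂ Y : Type*} [MeasurableSpace X₁] [MeasurableSpace X₂]
    [MeasurableSpace Y]
    {Q₁ : Measure X₁} {Q₂ : Measure X₂} [SFinite Q₁] [SFinite Q₂] {ν : Measure Y} [SFinite ν]
    {R : (X₁ × X₂) × Y → Prop} (h : ∀ᵐ z ∂(Q₁.prod Q₂).prod ν, R z) :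
    ∀ᵐ w ∂Q₂, ∀ᵐ z ∂Q₁.prod ν, R ((z.1, w), z.2) := by
  have hmp : MeasurePreserving (fun z : X₂ × (X₁ × Y) => ((z.2.1, z.1), z.2.2))
      (Q₂.prod (Q₁.prod ν)) ((Q₁.prod Q₂).prod ν) :=
    ((Measure.measurePreserving_swap (μ := Q₂) (ν := Q₁)).prod (MeasurePreserving.id ν)).comp
      (measurePreserving_prodAssoc Q₂ Q₁ ν).symm
  exact Measure.ae_ae_of_ae_prod (hmp.quasiMeasurePreserving.ae h)

/-- Serves to make the independent copy in `X₂` part of the parameter space. -/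
theorem ae_rearrange_right {X₁ X₂ Y : Type*} [MeasurableSpace X₁] [MeasurableSpace X₂]
    [MeasurableSpace Y]
    {Q₁ : Measure X₁} {Q₂ : Measure X₂} [SFinite Q₁] [SFinite Q₂] {ν : Measure Y} [SFinite ν]
    {R : (X₁ × X₂) × Y → Prop} (h : ∀ᵐ z ∂(Q₁.prod Q₂).prod ν, R z) :
    ∀ᵐ z ∂Q₁.prod (ν.prod Q₂), R ((z.1, z.2.2), z.2.1) := by
  have hmp : MeasurePreserving (fun z : X₁ × (Y × X₂) => ((z.1, z.2.2), z.2.1))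
      (Q₁.prod (ν.prod Q₂)) ((Q₁.prod Q₂).prod ν) :=
    (measurePreserving_prodAssoc Q₁ Q₂ ν).symm.comp
      ((MeasurePreserving.id Q₁).prod (Measure.measurePreserving_swap (μ := ν) (ν := Q₂)))
  exact hmp.quasiMeasurePreserving.ae h

/-! ### Moments of martingales -/

theorem integrable_of_lintegral_rpow_enorm_lt_top {B : Type*} [NormedAddCommGroup B]
    [SecondCountableTopology B] [MeasurableSpace B] [BorelSpace B] {Ω : Type*} [MeasurableSpace Ω]
    {P : Measure Ω} [IsProbabilityMeasure P] {p : ℝ} (hp : 1 ≤ p) {g : Ω → B} (hg : Measurable g)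
    (h : ∫⁻ ω, ‖g ω‖ₑ ^ p ∂P < ∞) : Integrable g P := by
  have hp0 : 0 < p := by linarith
  have hmem : MemLp g (ENNReal.ofReal p) P := by
    refine ⟨hg.aestronglyMeasurable, ?_⟩
    rw [eLpNorm_lt_top_iff_lintegral_rpow_enorm_lt_top (by simpa using hp0) ENNReal.ofReal_ne_top,
      ENNReal.toReal_ofReal hp0.le]
    exact h
  exact hmem.integrable (by simpa using hp)

section moment


variable {B : Type*} [NormedAddCommGroup B] [SecondCountableTopology B]
  [MeasurableSpace B] [BorelSpace B]
  {S : Type*} [MeasurableSpace S] {μ : Measure S} [IsProbabilityMeasure μ]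
  {Y : Type*} [MeasurableSpace Y] {ν : Measure Y} [SFinite ν]

/-- Almost every section of a function with finite `p`-th moment is integrable. -/
theorem ae_integrable_splice {p : ℝ} (hp : 1 ≤ p) (A : Set ℕ)
    {D : (ℕ → S) × Y → B} (hD : Measurable D)
    (hfin : ∫⁻ z, ‖D z‖ₑ ^ p ∂(iidLaw ℕ μ).prod ν ≠ ∞) :
    ∀ᵐ z ∂(iidLaw ℕ μ).prod ν,
      Integrable (fun w => D (splice A z.1 w, z.2)) (iidLaw ℕ μ) := by
  have hF : Measurable fun z => ‖D z‖ₑ ^ p := by fun_prop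
  have h1 : Measurable fun z : (ℕ → S) × Y =>
      ∫⁻ w, ‖D (splice A z.1 w, z.2)‖ₑ ^ p ∂iidLaw ℕ μ :=
    Measurable.lintegral_prod_right' (f := fun z : ((ℕ → S) × Y) × (ℕ → S) =>
      ‖D (splice A z.1.1 z.2, z.1.2)‖ₑ ^ p) (by fun_prop)
  rw [← lintegral_splice_prod μ A ν hF] at hfin
  filter_upwards [ae_lt_top h1 hfin] with z hz
  exact integrable_of_lintegral_rpow_enorm_lt_top hp (by fun_prop) hz

variable [NormedSpace ℝ B] [CompleteSpace B]

/-- The integrated two-point inequality bounds the moments of `T + D` and `T - D` together. Since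
`T` ignores coordinate `k` and `D` is centred in it, Jensen's inequality shows that `T - D` has at
least the moment of `T`; one copy of this finite moment cancels. -/
theorem lintegral_seminorm_add_le {p : ℝ} (hp : 1 ≤ p) {ψ : Seminorm ℝ B} {C : ℝ≥0}
    (hψ : IsTwoPointNorm p ψ C)
    (k : ℕ) {T D : (ℕ → S) × Y → B} (hT : Measurable T) (hD : Measurable D)
    (hTk : ∀ x w y, T (splice {k}ᶜ x w, y) = T (x, y))
    (hD0 : ∀ᵐ z ∂(iidLaw ℕ μ).prod ν, ∫ w, D (splice {k}ᶜ z.1 w, z.2) ∂iidLaw ℕ μ = 0)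
    (hDfin : ∫⁻ z, ‖D z‖ₑ ^ p ∂(iidLaw ℕ μ).prod ν ≠ ∞)
    (hTfin : ∫⁻ z, ENNReal.ofReal (ψ (T z) ^ p) ∂(iidLaw ℕ μ).prod ν ≠ ∞) :
    ∫⁻ z, ENNReal.ofReal (ψ (T z + D z) ^ p) ∂(iidLaw ℕ μ).prod ν ≤
      ∫⁻ z, ENNReal.ofReal (ψ (T z) ^ p) ∂(iidLaw ℕ μ).prod ν +
        C * ∫⁻ z, ENNReal.ofReal (ψ (D z) ^ p) ∂(iidLaw ℕ μ).prod ν := by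
  have hψm : Measurable ψ := (continuous_of_le_mul_norm ψ hψ.le_norm).measurable
  have hsub : Measurable fun z => ENNReal.ofReal (ψ (T z - D z) ^ p) := by fun_prop
  have hjensen : ∫⁻ z, ENNReal.ofReal (ψ (T z) ^ p) ∂(iidLaw ℕ μ).prod ν ≤
      ∫⁻ z, ENNReal.ofReal (ψ (T z - D z) ^ p) ∂(iidLaw ℕ μ).prod ν := by
    rw [← lintegral_splice_prod μ {k}ᶜ ν hsub]
    refine lintegral_mono_ae ?_
    filter_upwards [hD0, ae_integrable_splice hp {k}ᶜ hD hDfin] with z hz hi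
    simp only [hTk]
    exact ofReal_seminorm_rpow_le_lintegral ψ hψ.le_norm hp hi hz (T z)
  have hsum : ∫⁻ z, ENNReal.ofReal (ψ (T z + D z) ^ p) ∂(iidLaw ℕ μ).prod ν +
      ∫⁻ z, ENNReal.ofReal (ψ (T z - D z) ^ p) ∂(iidLaw ℕ μ).prod ν ≤
      2 * ∫⁻ z, ENNReal.ofReal (ψ (T z) ^ p) ∂(iidLaw ℕ μ).prod ν +
        C * ∫⁻ z, ENNReal.ofReal (ψ (D z) ^ p) ∂(iidLaw ℕ μ).prod ν := by
    rw [← lintegral_add_right _ hsub, ← lintegral_const_mul _ (by fun_prop),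
      ← lintegral_const_mul _ (by fun_prop), ← lintegral_add_right _ (by fun_prop)]
    refine lintegral_mono fun z => ?_
    have e1 : (C : ℝ≥0∞) = ENNReal.ofReal C := (ENNReal.ofReal_coe_nnreal).symm
    have e2 : (2 : ℝ≥0∞) = ENNReal.ofReal 2 := by simp
    rw [← ENNReal.ofReal_add (by positivity) (by positivity), e1, e2,
      ← ENNReal.ofReal_mul (by positivity), ← ENNReal.ofReal_mul (by positivity),
      ← ENNReal.ofReal_add (by positivity) (by positivity)]
    exact ENNReal.ofReal_le_ofReal (hψ.two_point (T z) (D z))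
  set a := ∫⁻ z, ENNReal.ofReal (ψ (T z) ^ p) ∂(iidLaw ℕ μ).prod ν
  have h2 := (add_le_add_right hjensen _).trans hsum
  rw [two_mul, add_assoc, add_comm] at h2
  exact (ENNReal.add_le_add_iff_left hTfin).1 h2

/-- Moment inequality for the sums of a martingale difference sequence on a product space. -/
theorem lintegral_enorm_sum_rpow_le {p : ℝ} (hp : 1 ≤ p) {ψ : Seminorm ℝ B} {C : ℝ≥0}
    (hψ : IsTwoPointNorm p ψ C)
    {d : ℕ → (ℕ → S) × Y → B} (hd : ∀ k, Measurable (d k))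
    (hdep : ∀ k x x' y, (∀ i ≤ k, x i = x' i) → d k (x, y) = d k (x', y)) {n : ℕ}
    (hd0 : ∀ k < n, ∀ᵐ z ∂(iidLaw ℕ μ).prod ν,
      ∫ w, d k (splice {k}ᶜ z.1 w, z.2) ∂iidLaw ℕ μ = 0)
    (hfin : ∀ k < n, ∫⁻ z, ‖d k z‖ₑ ^ p ∂(iidLaw ℕ μ).prod ν ≠ ∞) :
    ∫⁻ z, ‖∑ k ∈ Finset.range n, d k z‖ₑ ^ p ∂(iidLaw ℕ μ).prod ν ≤
      ((C : ℝ≥0∞) ^ p * C * (C : ℝ≥0∞) ^ p) *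
        ∑ k ∈ Finset.range n, ∫⁻ z, ‖d k z‖ₑ ^ p ∂(iidLaw ℕ μ).prod ν := by
  have hp0 : 0 ≤ p := by linarith
  have hψm : Measurable ψ := (continuous_of_le_mul_norm ψ hψ.le_norm).measurable
  -- The two factors `C ^ p` of the constant come from exchanging the norm for `ψ` and back, the
  -- middle `C` from the two-point inequality.
  have hle : ∀ x, ENNReal.ofReal (ψ x ^ p) ≤ (C : ℝ≥0∞) ^ p * ‖x‖ₑ ^ p := by
    intro x
    rw [← ENNReal.mul_rpow_of_nonneg _ _ hp0, ← ofReal_norm, ← ENNReal.ofReal_coe_nnreal,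
      ← ENNReal.ofReal_mul C.coe_nonneg, ENNReal.ofReal_rpow_of_nonneg (by positivity) hp0]
    exact ENNReal.ofReal_le_ofReal (Real.rpow_le_rpow (apply_nonneg ψ x) (hψ.le_norm x) hp0)
  have hge : ∀ x, ‖x‖ₑ ^ p ≤ (C : ℝ≥0∞) ^ p * ENNReal.ofReal (ψ x ^ p) := by
    intro x
    rw [← ENNReal.ofReal_rpow_of_nonneg (apply_nonneg ψ x) hp0,
      ← ENNReal.mul_rpow_of_nonneg _ _ hp0, ← ofReal_norm, ← ENNReal.ofReal_coe_nnreal,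
      ← ENNReal.ofReal_mul C.coe_nonneg]
    exact ENNReal.rpow_le_rpow (ENNReal.ofReal_le_ofReal (hψ.norm_le x)) hp0
  have hψfin : ∀ k < n, ∫⁻ z, ENNReal.ofReal (ψ (d k z) ^ p) ∂(iidLaw ℕ μ).prod ν ≠ ∞ := by
    intro k hk
    refine ne_top_of_le_ne_top ?_ (lintegral_mono fun z => hle (d k z))
    rw [lintegral_const_mul _ (by fun_prop)]
    exact ENNReal.mul_ne_top (ENNReal.rpow_ne_top_of_nonneg hp0 ENNReal.coe_ne_top) (hfin k hk)
  have main : ∀ j ≤ n,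
      ∫⁻ z, ENNReal.ofReal (ψ (∑ k ∈ Finset.range j, d k z) ^ p) ∂(iidLaw ℕ μ).prod ν ≤
        C * ∑ k ∈ Finset.range j,
          ∫⁻ z, ENNReal.ofReal (ψ (d k z) ^ p) ∂(iidLaw ℕ μ).prod ν := by
    intro j
    induction j with
    | zero =>
      intro _
      simp [Real.zero_rpow (by linarith : p ≠ 0)]
    | succ j ih =>
      intro hj
      have ih := ih (by omega)
      simp only [Finset.sum_range_succ]
      rw [mul_add]
      refine (lintegral_seminorm_add_le hp hψ j (by fun_prop) (hd j) ?_ (hd0 j (by omega))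
        (hfin j (by omega)) ?_).trans (by gcongr)
      · intro x w y
        refine Finset.sum_congr rfl fun k hk => hdep k _ _ y fun i hi => ?_
        have := Finset.mem_range.1 hk
        exact splice_compl_singleton_of_ne (by omega)
      · refine ne_top_of_le_ne_top (ENNReal.mul_ne_top ENNReal.coe_ne_top ?_) ih
        rw [ENNReal.sum_ne_top]
        intro k hk
        exact hψfin k (by have := Finset.mem_range.1 hk; omega)
  calc ∫⁻ z, ‖∑ k ∈ Finset.range n, d k z‖ₑ ^ p ∂(iidLaw ℕ μ).prod ν
      ≤ (C : ℝ≥0∞) ^ p * ∫⁻ z, ENNReal.ofReal (ψ (∑ k ∈ Finset.range n, d k z) ^ p)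
          ∂(iidLaw ℕ μ).prod ν := by
        rw [← lintegral_const_mul _ (by fun_prop)]
        exact lintegral_mono fun z => hge _
    _ ≤ (C : ℝ≥0∞) ^ p * (C * ∑ k ∈ Finset.range n,
          ((C : ℝ≥0∞) ^ p * ∫⁻ z, ‖d k z‖ₑ ^ p ∂(iidLaw ℕ μ).prod ν)) := by
        gcongr
        refine (main n le_rfl).trans ?_
        gcongr with k hk
        rw [← lintegral_const_mul _ (by fun_prop)]
        exact lintegral_mono fun z => hle _
    _ = _ := by rw [← Finset.mul_sum]; ring

end moment

/-! ### A good-λ inequality -/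

/-- The `p`-th power of the norm of `g` in `L^p(ν; B)`. -/
noncomputable def pInt {B Y : Type*} [NormedAddCommGroup B] [MeasurableSpace Y] (p : ℝ)
    (ν : Measure Y) (g : Y → B) : ℝ≥0∞ := ∫⁻ y, ‖g y‖ₑ ^ p ∂ν

section pInt

variable {B : Type*} [NormedAddCommGroup B] {Y : Type*} [MeasurableSpace Y] {ν : Measure Y}
  {p : ℝ}

theorem pInt_zero (hp : 0 < p) : pInt p ν (fun _ => (0 : B)) = 0 := by
  simp [pInt, ENNReal.zero_rpow_of_pos hp]

/-- The largest of the `p`-th powers of the norms of the first `N` partial sums. -/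
noncomputable def maxSum {B X Y : Type*} [NormedAddCommGroup B] [MeasurableSpace Y] (p : ℝ)
    (ν : Measure Y) (d : ℕ → X × Y → B) (N : ℕ) (x : X) : ℝ≥0∞ :=
  (Finset.range (N + 1)).sup fun n => pInt p ν fun y => ∑ k ∈ Finset.range n, d k (x, y)

/-- The predictable `p`-variation of the increment `d k`. -/
noncomputable def predVar {B S Y : Type*} [NormedAddCommGroup B] [MeasurableSpace Y]
    [MeasurableSpace S] (μ : Measure S) (p : ℝ) (ν : Measure Y) (d : ℕ → (ℕ → S) × Y → B) (k : ℕ)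
    (x : ℕ → S) : ℝ≥0∞ :=
  ∫⁻ w, pInt p ν (fun y => d k (splice {k}ᶜ x w, y)) ∂iidLaw ℕ μ

theorem lt_maxSum_iff {X : Type*} {d : ℕ → X × Y → B} {N : ℕ} {x : X} {a : ℝ≥0∞} :
    a < maxSum p ν d N x ↔
      ∃ n ≤ N, a < pInt p ν fun y => ∑ k ∈ Finset.range n, d k (x, y) := by
  simp [maxSum, Finset.lt_sup_iff]

theorem maxSum_mono {X : Type*} {d : ℕ → X × Y → B} {x : X} :
    Monotone fun N => maxSum p ν d N x := fun M N h =>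
  Finset.sup_mono (Finset.range_mono (by omega))

variable [SecondCountableTopology B] [MeasurableSpace B] [BorelSpace B]

theorem pInt_add_le (hp : 1 ≤ p) {f g : Y → B} (hf : Measurable f) :
    pInt p ν (fun y => f y + g y) ≤ 2 ^ (p - 1) * (pInt p ν f + pInt p ν g) := by
  rw [pInt, pInt, pInt, ← lintegral_add_left (by fun_prop),
    ← lintegral_const_mul' _ _ (ENNReal.rpow_ne_top_of_nonneg (by linarith) ENNReal.ofNat_ne_top)]
  refine lintegral_mono fun y => ?_
  exact (ENNReal.rpow_le_rpow (enorm_add_le _ _) (by linarith)).trans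
    (ENNReal.rpow_add_le_mul_rpow_add_rpow _ _ hp)

theorem measurable_pInt [SFinite ν] {X : Type*} [MeasurableSpace X] {F : X × Y → B}
    (hF : Measurable F) : Measurable fun x => pInt p ν fun y => F (x, y) :=
  Measurable.lintegral_prod_right' (f := fun z => ‖F z‖ₑ ^ p) (by fun_prop)

theorem lintegral_pInt [SFinite ν] {X : Type*} [MeasurableSpace X] {Q : Measure X}
    {F : X × Y → B} (hF : Measurable F) :
    ∫⁻ x, pInt p ν (fun y => F (x, y)) ∂Q = ∫⁻ z, ‖F z‖ₑ ^ p ∂Q.prod ν := by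
  rw [lintegral_prod _ (by fun_prop)]
  rfl

/-- If partial sums with small increments cross a high level, then the part of the sum
between the crossings of a low and of the high level is large. -/
theorem lt_pInt_sum_of_crossing (hp : 1 ≤ p) {d : ℕ → Y → B} (hd : ∀ k, Measurable (d k)) {N : ℕ}
    {b l : ℝ≥0∞} (hb : b = 2 ^ (p - 1) * (1 + 2 * 2 ^ (p - 1)))
    (hcross : ∃ n ≤ N, b * l < pInt p ν fun y => ∑ k ∈ Finset.range n, d k y)
    (hsmall : ∀ k < N, pInt p ν (d k) ≤ l) {V : ℕ → Prop} [DecidablePred V]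
    (hV : ∀ k < N, V k ↔ (∃ j ≤ k, l < pInt p ν fun y => ∑ i ∈ Finset.range j, d i y) ∧
      ∀ j ≤ k, (pInt p ν fun y => ∑ i ∈ Finset.range j, d i y) ≤ b * l) :
    l < pInt p ν fun y => ∑ k ∈ Finset.range N, if V k then d k y else 0 := by
  classical
  set M : ℕ → ℝ≥0∞ := fun n => pInt p ν fun y => ∑ k ∈ Finset.range n, d k y with hM
  set c : ℝ≥0∞ := 2 ^ (p - 1) with hc
  have hc1 : 1 ≤ c := by
    rcases hp.eq_or_lt with h1 | h1
    · rw [hc, ← h1]; simp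
    · exact ENNReal.one_le_rpow (by norm_num) (by linarith)
  have hb1 : 1 ≤ b := by
    rw [hb]
    calc (1 : ℝ≥0∞) = 1 * (1 + 0) := by simp
      _ ≤ c * (1 + 2 * c) := by gcongr; exact zero_le
  have hM0 : M 0 = 0 := by
    simp only [hM, Finset.range_zero, Finset.sum_empty]
    exact pInt_zero (by linarith)
  have hσ : ∃ n, b * l < M n := by obtain ⟨n, -, h⟩ := hcross; exact ⟨n, h⟩
  have hlb : l ≤ b * l := le_mul_of_one_le_left zero_le hb1
  have hτ : ∃ n, l < M n := by obtain ⟨n, h⟩ := hσ; exact ⟨n, hlb.trans_lt h⟩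
  -- `σ` and `τ` are the first times above the high level `b * l` and the low level `l`; the
  -- increments kept by `V` are those with `τ ≤ k < σ`.
  set σ := Nat.find hσ with hσdef
  set τ := Nat.find hτ with hτdef
  have hστ : τ ≤ σ := Nat.find_min' hτ (hlb.trans_lt (Nat.find_spec hσ))
  have hσN : σ ≤ N := by
    obtain ⟨n, hn, h⟩ := hcross
    exact (Nat.find_min' hσ h).trans hn
  have hVk : ∀ k < N, (V k ↔ τ ≤ k ∧ k < σ) := by
    intro k hk
    rw [hV k hk]
    refine and_congr ⟨?_, ?_⟩ ⟨?_, ?_⟩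
    · rintro ⟨j, hj, h⟩; exact (Nat.find_min' hτ h).trans hj
    · intro h; exact ⟨τ, h, Nat.find_spec hτ⟩
    · intro h
      by_contra hcon
      exact absurd (Nat.find_spec hσ) (not_lt.2 (h σ (not_lt.1 hcon)))
    · intro h j hj
      exact not_lt.1 (Nat.find_min hσ (lt_of_le_of_lt hj h))
  have hT : ∀ y, (∑ k ∈ Finset.range N, if V k then d k y else 0) =
      (∑ k ∈ Finset.range σ, d k y) - ∑ k ∈ Finset.range τ, d k y := by
    intro y
    rw [← Finset.sum_Ico_eq_sub _ hστ, ← Finset.sum_filter]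
    refine Finset.sum_congr ?_ fun _ _ => rfl
    ext k
    simp only [Finset.mem_filter, Finset.mem_range, Finset.mem_Ico]
    constructor
    · rintro ⟨h1, h2⟩; exact (hVk k h1).1 h2
    · intro h
      have : k < N := by omega
      exact ⟨this, (hVk k this).2 h⟩
  simp only [hT]
  by_contra hcon
  rw [not_lt] at hcon
  have hτpos : τ ≠ 0 := by
    intro h0
    have := Nat.find_spec hτ
    rw [← hτdef, h0, hM0] at this
    exact not_lt_zero this
  obtain ⟨j, hj⟩ := Nat.exists_eq_succ_of_ne_zero hτpos
  -- Just before `τ` the level `l` is not exceeded, and one small increment is added. A second use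
  -- of the quasi-triangle inequality then bounds `M σ` by `c (1 + 2 c) l = b l`, a contradiction;
  -- this is the origin of `b`.
  have hMτ : M τ ≤ c * (l + l) := by
    rw [hj]
    simp only [hM, Finset.sum_range_succ]
    refine (pInt_add_le hp (by fun_prop)).trans ?_
    gcongr
    · exact not_lt.1 (Nat.find_min hτ (m := j) (by omega))
    · exact hsmall j (by omega)
  have hMσ : M σ ≤ b * l := by
    calc M σ = pInt p ν fun y => ((∑ k ∈ Finset.range σ, d k y) - ∑ k ∈ Finset.range τ, d k y) +
          ∑ k ∈ Finset.range τ, d k y := by simp [hM]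
      _ ≤ c * (l + c * (l + l)) := by
          refine (pInt_add_le hp (by fun_prop)).trans ?_
          gcongr
      _ = b * l := by rw [hb]; ring
  exact absurd (Nat.find_spec hσ) (not_lt.2 hMσ)

theorem measurable_maxSum [SFinite ν] {X : Type*} [MeasurableSpace X] {d : ℕ → X × Y → B}
    (hd : ∀ k, Measurable (d k)) (N : ℕ) : Measurable (maxSum p ν d N) := by
  have h : ∀ n, Measurable fun x => pInt p ν fun y => ∑ k ∈ Finset.range n, d k (x, y) :=
    fun n => measurable_pInt (F := fun z => ∑ k ∈ Finset.range n, d k z) (by fun_prop)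
  have e : maxSum p ν d N = fun x => ⨆ n ∈ Finset.range (N + 1),
      pInt p ν fun y => ∑ k ∈ Finset.range n, d k (x, y) := by
    funext x; rw [maxSum, Finset.sup_eq_iSup]
  rw [e]
  exact Measurable.iSup fun n => Measurable.iSup fun _ => h n

variable {S : Type*} [MeasurableSpace S] {μ : Measure S} [IsProbabilityMeasure μ] [SFinite ν]

theorem measurable_predVar {d : ℕ → (ℕ → S) × Y → B} (hd : ∀ k, Measurable (d k)) (k : ℕ) :
    Measurable (predVar μ p ν d k) := by
  refine Measurable.lintegral_prod_right' (f := fun z : (ℕ → S) × (ℕ → S) =>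
    pInt p ν fun y => d k (splice {k}ᶜ z.1 z.2, y)) ?_
  exact measurable_pInt (F := fun z : ((ℕ → S) × (ℕ → S)) × Y =>
    d k (splice {k}ᶜ z.1.1 z.1.2, z.2)) (by fun_prop)

end pInt

section goodLambda

variable {B : Type*} [NormedAddCommGroup B] [NormedSpace ℝ B] [CompleteSpace B]
  [SecondCountableTopology B] [MeasurableSpace B] [BorelSpace B]
  {S : Type*} [MeasurableSpace S] {μ : Measure S} [IsProbabilityMeasure μ]
  {Y : Type*} [MeasurableSpace Y] {ν : Measure Y} [SFinite ν]

/-- Increments are kept only between the crossings of `l` and `b * l`, and only while the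
predictable variation stays below `δ * l`. The transformed martingale has `p`-th moment at most a
constant times `δ * l` times the probability of crossing `l`, so Markov's inequality at level `l`
gives the first term. Outside the exceptional events of the other two terms, crossing `b * l` forces
the transformed sum above `l`. -/
theorem measure_lt_maxSum_le {p : ℝ} (hp : 1 ≤ p) {ψ : Seminorm ℝ B} {C : ℝ≥0}
    (hψ : IsTwoPointNorm p ψ C)
    {d : ℕ → (ℕ → S) × Y → B} (hd : ∀ k, Measurable (d k))
    (hdep : ∀ k x x' y, (∀ i ≤ k, x i = x' i) → d k (x, y) = d k (x', y)) {N : ℕ}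
    (hd0 : ∀ k < N, ∀ᵐ z ∂(iidLaw ℕ μ).prod ν,
      ∫ w, d k (splice {k}ᶜ z.1 w, z.2) ∂iidLaw ℕ μ = 0)
    (hfin : ∀ k < N, ∫⁻ z, ‖d k z‖ₑ ^ p ∂(iidLaw ℕ μ).prod ν ≠ ∞)
    {b δ l : ℝ≥0∞} (hb : b = 2 ^ (p - 1) * (1 + 2 * 2 ^ (p - 1))) (hδ : δ ≤ 1)
    (hl0 : l ≠ 0) (hl : l ≠ ∞) :
    iidLaw ℕ μ {x | b * l < maxSum p ν d N x} ≤
      ((C : ℝ≥0∞) ^ p * C * (C : ℝ≥0∞) ^ p) * δ * iidLaw ℕ μ {x | l < maxSum p ν d N x} +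
        (∑ k ∈ Finset.range N, iidLaw ℕ μ {x | δ * l < pInt p ν fun y => d k (x, y)} +
          iidLaw ℕ μ {x | δ * l < ∑ k ∈ Finset.range N, predVar μ p ν d k x}) := by
  classical
  set Q := iidLaw ℕ μ with hQ
  set K : ℝ≥0∞ := (C : ℝ≥0∞) ^ p * C * (C : ℝ≥0∞) ^ p with hK
  have hp0 : 0 < p := by linarith
  have hmax := measurable_maxSum (p := p) (ν := ν) hd
  have hpv := measurable_predVar (μ := μ) (p := p) (ν := ν) hd
  have hδl : δ * l ≤ l := mul_le_of_le_one_left zero_le hδ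
  -- the predictable events on which increments are kept
  set V : ℕ → Set (ℕ → S) := fun k => {x | l < maxSum p ν d k x ∧ maxSum p ν d k x ≤ b * l ∧
    ∑ j ∈ Finset.range (k + 1), predVar μ p ν d j x ≤ δ * l} with hV
  have hVm : ∀ k, MeasurableSet (V k) := fun k =>
    (measurableSet_lt measurable_const (hmax k)).inter
      ((measurableSet_le (hmax k) measurable_const).inter
        (measurableSet_le (Finset.measurable_sum _ fun j _ => hpv j) measurable_const))
  -- Predictability: the variation may include the index `k` itself, because `predVar` integrates
  -- coordinate `k` out.
  have hVdep : ∀ k x x', (∀ i < k, x i = x' i) → (x ∈ V k ↔ x' ∈ V k) := by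
    intro k x x' h
    have e1 : maxSum p ν d k x = maxSum p ν d k x' := by
      refine Finset.sup_congr rfl fun n hn => ?_
      congr 1
      funext y
      refine Finset.sum_congr rfl fun j hj => hdep j x x' y fun i hi => h i ?_
      have := Finset.mem_range.1 hn
      have := Finset.mem_range.1 hj
      omega
    have e2 : ∀ j ∈ Finset.range (k + 1), predVar μ p ν d j x = predVar μ p ν d j x' := by
      intro j hj
      refine lintegral_congr fun w => ?_
      congr 1
      funext y
      refine hdep j _ _ y fun i hi => ?_
      have := Finset.mem_range.1 hj
      by_cases hij : i = j
      · subst hij; rw [splice_compl_singleton_self, splice_compl_singleton_self]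
      · rw [splice_compl_singleton_of_ne hij, splice_compl_singleton_of_ne hij]
        exact h i (by omega)
    simp only [hV, Set.mem_ofPred_eq, e1, Finset.sum_congr rfl e2]
  set d' : ℕ → (ℕ → S) × Y → B := fun k z => if z.1 ∈ V k then d k z else 0 with hd'
  have hd'm : ∀ k, Measurable (d' k) := fun k =>
    Measurable.ite (measurable_fst (hVm k)) (hd k) measurable_const
  have hd'dep : ∀ k x x' y, (∀ i ≤ k, x i = x' i) → d' k (x, y) = d' k (x', y) := by
    intro k x x' y h
    simp only [hd', hVdep k x x' fun i hi => h i hi.le, hdep k x x' y h]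
  have hVs : ∀ k x w, splice {k}ᶜ x w ∈ V k ↔ x ∈ V k := fun k x w =>
    hVdep k _ _ fun i hi => splice_compl_singleton_of_ne hi.ne
  have hd'0 : ∀ k < N, ∀ᵐ z ∂Q.prod ν, ∫ w, d' k (splice {k}ᶜ z.1 w, z.2) ∂Q = 0 := by
    intro k hk
    filter_upwards [hd0 k hk] with z hz
    simp only [hd', hVs]
    by_cases h : z.1 ∈ V k
    · simpa only [h, if_true] using hz
    · simp [h]
  have hle : ∀ k z, ‖d' k z‖ₑ ^ p ≤ ‖d k z‖ₑ ^ p := by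
    intro k z
    simp only [hd']
    split_ifs
    · exact le_rfl
    · simp [ENNReal.zero_rpow_of_pos hp0]
  have hd'fin : ∀ k < N, ∫⁻ z, ‖d' k z‖ₑ ^ p ∂Q.prod ν ≠ ∞ := fun k hk =>
    ne_top_of_le_ne_top (hfin k hk) (lintegral_mono fun z => hle k z)
  have hmom := lintegral_enorm_sum_rpow_le hp hψ hd'm hd'dep hd'0 hd'fin
  have hterm : ∀ k, ∫⁻ z, ‖d' k z‖ₑ ^ p ∂Q.prod ν =
      ∫⁻ x, (V k).indicator (predVar μ p ν d k) x ∂Q := by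
    intro k
    rw [← lintegral_pInt (hd'm k), ← lintegral_splice μ {k}ᶜ (measurable_pInt (hd'm k))]
    refine lintegral_congr fun x => ?_
    by_cases h : x ∈ V k
    · rw [Set.indicator_of_mem h]
      simp only [hd', hVs, h, if_true]
      rfl
    · rw [Set.indicator_of_notMem h]
      simp [hd', hVs, h, pInt_zero hp0]
  -- At the last `k` with `x ∈ V k`, all variation kept so far is part of the variation up to `k`,
  -- which `V k` bounds by `δ * l`.
  have hsumV : ∀ x, ∑ k ∈ Finset.range N, (V k).indicator (predVar μ p ν d k) x ≤
      {x | l < maxSum p ν d N x}.indicator (fun _ => δ * l) x := by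
    intro x
    by_cases hne : ((Finset.range N).filter fun k => x ∈ V k).Nonempty
    · obtain ⟨k, hk, hkmax⟩ := Finset.exists_max_image _ id hne
      simp only [Finset.mem_filter, Finset.mem_range, id] at hk hkmax
      have hx : x ∈ {x | l < maxSum p ν d N x} := hk.2.1.trans_le (maxSum_mono hk.1.le)
      rw [Set.indicator_of_mem hx]
      refine le_trans ?_ hk.2.2.2
      have h1 : ∀ j ∈ Finset.range N, j ∉ Finset.range (k + 1) →
          (V j).indicator (predVar μ p ν d j) x = 0 := by
        intro j hj hjk
        refine Set.indicator_of_notMem (fun hxj => hjk ?_) _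
        have := hkmax j ⟨Finset.mem_range.1 hj, hxj⟩
        exact Finset.mem_range.2 (by omega)
      rw [← Finset.sum_subset (Finset.range_mono (by omega : k + 1 ≤ N)) h1]
      exact Finset.sum_le_sum fun j _ => Set.indicator_le_self _ _ _
    · rw [Finset.not_nonempty_iff_eq_empty, Finset.filter_eq_empty_iff] at hne
      rw [Finset.sum_eq_zero fun k hk => Set.indicator_of_notMem (hne hk) _]
      exact zero_le
  have hT : Q {x | l < pInt p ν fun y => ∑ k ∈ Finset.range N, d' k (x, y)} ≤
      K * δ * Q {x | l < maxSum p ν d N x} := by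
    have hTm : Measurable fun z => ∑ k ∈ Finset.range N, d' k z := by fun_prop
    have h1 : ∫⁻ x, pInt p ν (fun y => ∑ k ∈ Finset.range N, d' k (x, y)) ∂Q ≤
        K * (δ * l * Q {x | l < maxSum p ν d N x}) := by
      rw [lintegral_pInt hTm]
      refine hmom.trans ?_
      gcongr
      refine (Finset.sum_congr rfl fun k _ => hterm k).trans_le ?_
      rw [← lintegral_finsetSum _ fun k _ => (hpv k).indicator (hVm k)]
      refine (lintegral_mono hsumV).trans ?_
      rw [lintegral_indicator_const (measurableSet_lt measurable_const (hmax N))]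
    have h2 := (mul_meas_ge_le_lintegral (μ := Q)
      (measurable_pInt (p := p) (ν := ν) hTm) l).trans h1
    have h3 : K * (δ * l * Q {x | l < maxSum p ν d N x}) =
        l * (K * δ * Q {x | l < maxSum p ν d N x}) := by ring
    rw [h3, ENNReal.mul_le_mul_iff_right hl0 hl] at h2
    exact (measure_mono fun x (hx : l < _) => hx.le).trans h2
  have hincl : {x | b * l < maxSum p ν d N x} ⊆
      {x | l < pInt p ν fun y => ∑ k ∈ Finset.range N, d' k (x, y)} ∪
      ((⋃ k ∈ Finset.range N, {x | δ * l < pInt p ν fun y => d k (x, y)}) ∪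
        {x | δ * l < ∑ k ∈ Finset.range N, predVar μ p ν d k x}) := by
    intro x hx
    by_contra hcon
    simp only [Set.mem_union, Set.mem_iUnion, Set.mem_ofPred_eq, not_or, not_exists, not_lt,
      Finset.mem_range] at hcon
    obtain ⟨h1, h2, h3⟩ := hcon
    refine absurd ?_ (not_lt.2 h1)
    refine lt_pInt_sum_of_crossing hp (d := fun k y => d k (x, y)) (V := fun k => x ∈ V k)
      (fun k => by fun_prop) hb (lt_maxSum_iff.1 hx) (fun k hk => (h2 k hk).trans hδl)
      fun k hk => ?_
    have h4 : ∑ j ∈ Finset.range (k + 1), predVar μ p ν d j x ≤ δ * l :=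
      (Finset.sum_le_sum_of_subset (Finset.range_mono (by omega))).trans h3
    simp only [hV, Set.mem_ofPred_eq, lt_maxSum_iff, h4, and_true]
    refine and_congr Iff.rfl ?_
    rw [← not_lt, lt_maxSum_iff]
    push Not
    rfl
  refine (measure_mono hincl).trans ((measure_union_le _ _).trans (add_le_add hT ?_))
  refine (measure_union_le _ _).trans (add_le_add_left ?_ _)
  exact measure_biUnion_finset_le _ _

end goodLambda

/-! ### Truncated moments of the maximum of a martingale -/

theorem measurable_tail {Ω : Type*} [MeasurableSpace Ω] (P : Measure Ω) (κ : ℝ) {t : ℝ}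
    (ht : 0 ≤ t) (Y : Ω → ℝ≥0∞) :
    Measurable fun u : ℝ =>
      ENNReal.ofReal (u ^ (κ - 1)) * P {ω | ENNReal.ofReal (t * u) < Y ω} := by
  have h : Antitone fun u : ℝ => P {ω | ENNReal.ofReal (t * u) < Y ω} := fun u v huv =>
    measure_mono fun ω (hω : _ < _) =>
      (ENNReal.ofReal_le_ofReal (mul_le_mul_of_nonneg_left huv ht)).trans_lt hω
  exact (by fun_prop : Measurable fun u : ℝ => ENNReal.ofReal (u ^ (κ - 1))).mul h.measurable

/-- Integrated form of a good-λ inequality. -/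
theorem lintegral_trunc_le_of_good_lambda {Ω ι : Type*} [MeasurableSpace Ω] {P : Measure Ω}
    [IsProbabilityMeasure P] {κ b δ : ℝ} (hκ : 0 < κ) (hb : 1 ≤ b) (hδ0 : 0 < δ) (hδ : δ ≤ 1)
    {ε : ℝ≥0∞} (hε : ENNReal.ofReal b ^ κ * ε ≤ 2⁻¹) {V : Ω → ℝ≥0∞} (hV : Measurable V)
    {s : Finset ι} {W : ι → Ω → ℝ≥0∞} (hW : ∀ i, Measurable (W i))
    (h : ∀ u : ℝ, 0 < u → P {ω | ENNReal.ofReal (b * u) < V ω} ≤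
      ε * P {ω | ENNReal.ofReal (1 * u) < V ω} +
        ∑ i ∈ s, P {ω | ENNReal.ofReal (δ * u) < W i ω}) :
    ∫⁻ ω, trunc κ (V ω) ∂P ≤
      2 * ENNReal.ofReal b ^ κ * (ENNReal.ofReal δ)⁻¹ ^ κ *
        ∑ i ∈ s, ∫⁻ ω, trunc κ (W i ω) ∂P := by
  have hb0 : 0 < b := by linarith
  have h1 : tailIntegral P κ b V ≤
      ε * tailIntegral P κ 1 V + ∑ i ∈ s, tailIntegral P κ δ (W i) := by
    simp only [tailIntegral]
    rw [← lintegral_const_mul _ (measurable_tail P κ zero_le_one V),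
      ← lintegral_finsetSum _ fun i _ => measurable_tail P κ hδ0.le (W i),
      ← lintegral_add_left ((measurable_tail P κ zero_le_one V).const_mul _)]
    refine setLIntegral_mono' measurableSet_Ioo fun u hu => ?_
    calc _ ≤ ENNReal.ofReal (u ^ (κ - 1)) * (ε * P {ω | ENNReal.ofReal (1 * u) < V ω} +
        ∑ i ∈ s, P {ω | ENNReal.ofReal (δ * u) < W i ω}) := by gcongr; exact h u hu.1
      _ = _ := by rw [mul_add, Finset.mul_sum]; ring
  have h2 : ∫⁻ ω, trunc κ (V ω / ENNReal.ofReal b) ∂P ≤ ε * ∫⁻ ω, trunc κ (V ω) ∂P +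
      ∑ i ∈ s, ∫⁻ ω, trunc κ (W i ω / ENNReal.ofReal δ) ∂P := by
    have h3 := lintegral_trunc P hκ one_pos hV.aemeasurable
    simp only [ENNReal.ofReal_one, div_one] at h3
    rw [lintegral_trunc P hκ hb0 hV.aemeasurable, h3,
      Finset.sum_congr rfl fun i _ => lintegral_trunc P hκ hδ0 (hW i).aemeasurable,
      ← Finset.mul_sum]
    calc _ ≤ ENNReal.ofReal κ * (ε * tailIntegral P κ 1 V +
        ∑ i ∈ s, tailIntegral P κ δ (W i)) := by gcongr
      _ = _ := by ring
  set I := ∫⁻ ω, trunc κ (V ω) ∂P with hI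
  -- Truncation makes the left side finite, so half of it can be absorbed below.
  have hI1 : I ≠ ∞ := by
    refine ne_top_of_le_ne_top ENNReal.one_ne_top
      ((lintegral_mono fun ω => trunc_le_one hκ (V ω)).trans ?_)
    simp
  have hbne : ENNReal.ofReal b ≠ 0 := by simpa using hb0
  have h4 : I ≤ ENNReal.ofReal b ^ κ * ∫⁻ ω, trunc κ (V ω / ENNReal.ofReal b) ∂P := by
    rw [← lintegral_const_mul _ (measurable_trunc (hV.div_const _))]
    refine lintegral_mono fun ω => ?_
    calc trunc κ (V ω) = trunc κ (ENNReal.ofReal b * (V ω / ENNReal.ofReal b)) := by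
          rw [ENNReal.mul_div_cancel hbne ENNReal.ofReal_ne_top]
      _ ≤ _ := trunc_mul_le hκ (by simpa using hb) _
  have h5 : ∀ i ∈ s, ∫⁻ ω, trunc κ (W i ω / ENNReal.ofReal δ) ∂P ≤
      (ENNReal.ofReal δ)⁻¹ ^ κ * ∫⁻ ω, trunc κ (W i ω) ∂P := by
    intro i _
    rw [← lintegral_const_mul _ (measurable_trunc (hW i))]
    refine lintegral_mono fun ω => ?_
    rw [div_eq_mul_inv, mul_comm]
    exact trunc_mul_le hκ (by rw [ENNReal.one_le_inv]; simpa using hδ) _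
  set R := ∑ i ∈ s, ∫⁻ ω, trunc κ (W i ω) ∂P with hR
  have h6 : I ≤ 2⁻¹ * I + ENNReal.ofReal b ^ κ * (ENNReal.ofReal δ)⁻¹ ^ κ * R := by
    calc I ≤ ENNReal.ofReal b ^ κ * (ε * I + (ENNReal.ofReal δ)⁻¹ ^ κ * R) := by
          refine h4.trans ?_
          gcongr
          refine h2.trans ?_
          gcongr
          rw [hR, Finset.mul_sum]
          exact Finset.sum_le_sum h5
      _ = (ENNReal.ofReal b ^ κ * ε) * I + ENNReal.ofReal b ^ κ * (ENNReal.ofReal δ)⁻¹ ^ κ * R := by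
          ring
      _ ≤ _ := by gcongr
  have h7 : 2⁻¹ * I + 2⁻¹ * I = I := by rw [← add_mul, ENNReal.inv_two_add_inv_two, one_mul]
  have h8 : 2⁻¹ * I ≤ ENNReal.ofReal b ^ κ * (ENNReal.ofReal δ)⁻¹ ^ κ * R := by
    refine (ENNReal.add_le_add_iff_left
      (ENNReal.mul_ne_top (ENNReal.inv_ne_top.2 two_ne_zero) hI1)).1 ?_
    rwa [h7]
  calc I = 2 * (2⁻¹ * I) := by
        rw [← mul_assoc, ENNReal.mul_inv_cancel two_ne_zero ENNReal.ofNat_ne_top, one_mul]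
    _ ≤ 2 * (ENNReal.ofReal b ^ κ * (ENNReal.ofReal δ)⁻¹ ^ κ * R) := by gcongr
    _ = _ := by ring

/-- The truncated moments of the maximum of a martingale are controlled by those of the
increments and of the predictable variation. -/
theorem exists_lintegral_trunc_maxSum_le {B : Type*} [NormedAddCommGroup B] [NormedSpace ℝ B]
    [CompleteSpace B] [SecondCountableTopology B] [MeasurableSpace B] [BorelSpace B]
    {p : ℝ} (hp : 1 ≤ p) {ψ : Seminorm ℝ B} {C : ℝ≥0} (hψ : IsTwoPointNorm p ψ C)
    {κ : ℝ} (hκ : 0 < κ) :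
    ∃ K : ℝ≥0, ∀ (S : Type v) [MeasurableSpace S] (μ : Measure S) [IsProbabilityMeasure μ]
      (Y : Type v) [MeasurableSpace Y] (ν : Measure Y) [SFinite ν]
      (d : ℕ → (ℕ → S) × Y → B) (_ : ∀ k, Measurable (d k))
      (_ : ∀ k x x' y, (∀ i ≤ k, x i = x' i) → d k (x, y) = d k (x', y)) (N : ℕ)
      (_ : ∀ k < N, ∀ᵐ z ∂(iidLaw ℕ μ).prod ν,
        ∫ w, d k (splice {k}ᶜ z.1 w, z.2) ∂iidLaw ℕ μ = 0)
      (_ : ∀ k < N, ∫⁻ z, ‖d k z‖ₑ ^ p ∂(iidLaw ℕ μ).prod ν ≠ ∞),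
      ∫⁻ x, trunc κ (maxSum p ν d N x) ∂iidLaw ℕ μ ≤
        K * (∑ k ∈ Finset.range N, ∫⁻ x, trunc κ (pInt p ν fun y => d k (x, y)) ∂iidLaw ℕ μ +
          ∫⁻ x, trunc κ (∑ k ∈ Finset.range N, predVar μ p ν d k x) ∂iidLaw ℕ μ) := by
  set b : ℝ := 2 ^ (p - 1) * (1 + 2 * 2 ^ (p - 1)) with hb
  have h2p : (1 : ℝ) ≤ 2 ^ (p - 1) := Real.one_le_rpow (by norm_num) (by linarith)
  have hb1 : 1 ≤ b := by rw [hb]; nlinarith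
  have hb' : ENNReal.ofReal b = 2 ^ (p - 1) * (1 + 2 * 2 ^ (p - 1)) := by
    have e : ENNReal.ofReal (2 ^ (p - 1)) = 2 ^ (p - 1) := by
      rw [← ENNReal.ofReal_rpow_of_pos (by norm_num)]; simp
    rw [hb, ENNReal.ofReal_mul (by positivity), ENNReal.ofReal_add (by norm_num) (by positivity),
      ENNReal.ofReal_mul (by norm_num), e]
    simp
  set K₀ : ℝ := (C : ℝ) ^ p * C * (C : ℝ) ^ p with hK₀
  have hK₀0 : 0 ≤ K₀ := by positivity
  have hK₀' : ENNReal.ofReal K₀ = (C : ℝ≥0∞) ^ p * C * (C : ℝ≥0∞) ^ p := by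
    rw [hK₀, ENNReal.ofReal_mul (by positivity), ENNReal.ofReal_mul (by positivity),
      ← ENNReal.ofReal_rpow_of_nonneg C.coe_nonneg (by linarith), ENNReal.ofReal_coe_nnreal]
  have hbκ : 0 ≤ b ^ κ := by positivity
  -- Chosen so that `b ^ κ * K₀ * δ ≤ 1 / 2`, as the absorption requires.
  set δ : ℝ := (1 + 2 * K₀ * b ^ κ)⁻¹ with hδ
  have hδ0 : 0 < δ := by positivity
  have hδ1 : δ ≤ 1 := inv_le_one_of_one_le₀ (by nlinarith [mul_nonneg hK₀0 hbκ])
  have hε : ENNReal.ofReal b ^ κ * (ENNReal.ofReal K₀ * ENNReal.ofReal δ) ≤ 2⁻¹ := by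
    rw [ENNReal.ofReal_rpow_of_pos (by linarith), ← ENNReal.ofReal_mul hK₀0,
      ← ENNReal.ofReal_mul hbκ,
      show (2⁻¹ : ℝ≥0∞) = ENNReal.ofReal 2⁻¹ by rw [ENNReal.ofReal_inv_of_pos two_pos]; simp]
    refine ENNReal.ofReal_le_ofReal ?_
    rw [hδ, ← mul_assoc, ← div_eq_mul_inv, div_le_iff₀ (by positivity)]
    nlinarith [mul_nonneg hK₀0 hbκ]
  set K : ℝ≥0∞ := 2 * ENNReal.ofReal b ^ κ * (ENNReal.ofReal δ)⁻¹ ^ κ with hK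
  have hKtop : K ≠ ∞ := by
    refine ENNReal.mul_ne_top (ENNReal.mul_ne_top ENNReal.ofNat_ne_top ?_) ?_
    · exact ENNReal.rpow_ne_top_of_nonneg hκ.le ENNReal.ofReal_ne_top
    · exact ENNReal.rpow_ne_top_of_nonneg hκ.le (by simpa using hδ0)
  refine ⟨K.toNNReal, fun S _ μ _ Y _ ν _ d hd hdep N hd0 hfin => ?_⟩
  rw [ENNReal.coe_toNNReal hKtop]
  -- The index `none` stands for the predictable variation, `some k` for the increment at `k`.
  set W : Option ℕ → (ℕ → S) → ℝ≥0∞ := fun o x =>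
    o.elim (∑ k ∈ Finset.range N, predVar μ p ν d k x) fun k => pInt p ν fun y => d k (x, y)
  have hW : ∀ o, Measurable (W o) := by
    rintro (_ | k)
    · exact Finset.measurable_sum _ fun j _ => measurable_predVar hd j
    · exact measurable_pInt (hd k)
  have main := lintegral_trunc_le_of_good_lambda (P := iidLaw ℕ μ) hκ hb1 hδ0 hδ1 hε
    (measurable_maxSum (p := p) (ν := ν) hd N) (s := Finset.insertNone (Finset.range N)) hW ?_
  · rw [Finset.sum_insertNone, add_comm] at main
    exact main
  · intro u hu
    rw [Finset.sum_insertNone, add_comm (iidLaw ℕ μ _)]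
    have := measure_lt_maxSum_le hp hψ hd hdep hd0 hfin (b := ENNReal.ofReal b)
      (δ := ENNReal.ofReal δ) (l := ENNReal.ofReal u) hb' (by simpa using hδ1) (by simpa using hu)
      ENNReal.ofReal_ne_top
    rw [← ENNReal.ofReal_mul (by linarith), ← ENNReal.ofReal_mul hδ0.le, ← hK₀'] at this
    rw [one_mul]
    exact this

/-! ### Sums over finite sets of indices -/

section finsets

open Finset

/-- A set of `m + 1` indices is its largest element `n` together with `m` smaller ones; this
exhibits the martingale structure in `n`. -/
theorem sum_powersetCard_succ_range {M : Type*} [AddCommMonoid M] (F : Finset ℕ → M) (m N : ℕ) :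
    ∑ I ∈ (range N).powersetCard (m + 1), F I =
      ∑ n ∈ range N, ∑ I ∈ (range n).powersetCard m, F (insert n I) := by
  induction N with
  | zero => rw [range_zero, powersetCard_eq_empty.2 (by simp)]; simp
  | succ N ih =>
    rw [sum_range_succ, ← ih, range_add_one, powersetCard_succ_insert notMem_range_self,
      sum_union, sum_image]
    · intro I hI J hJ h
      have hI' : N ∉ I := fun h => notMem_range_self ((mem_powersetCard.1 hI).1 h)
      have hJ' : N ∉ J := fun h => notMem_range_self ((mem_powersetCard.1 hJ).1 h)
      rw [← erase_insert hI', ← erase_insert hJ', h]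
    · rw [disjoint_left]
      intro I hI hI'
      obtain ⟨J, -, rfl⟩ := mem_image.1 hI'
      exact notMem_range_self ((mem_powersetCard.1 hI).1 (mem_insert_self N J))

theorem sum_powerset_range {M : Type*} [AddCommMonoid M] (F : Finset ℕ → M) (N : ℕ) :
    ∑ A ∈ (range N).powerset, F A =
      F ∅ + ∑ n ∈ range N, ∑ A ∈ (range n).powerset, F (insert n A) := by
  induction N with
  | zero => simp
  | succ N ih =>
    rw [sum_range_succ, ← add_assoc, ← ih, range_add_one, sum_powerset_insert notMem_range_self]

theorem insert_mem_powersetCard_range {m n N : ℕ} {I : Finset ℕ}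
    (hI : I ∈ (range n).powersetCard m) (hn : n < N) :
    insert n I ∈ (range N).powersetCard (m + 1) := by
  rw [mem_powersetCard] at hI ⊢
  refine ⟨insert_subset (mem_range.2 hn) (hI.1.trans (range_mono hn.le)), ?_⟩
  rw [card_insert_of_notMem fun h => notMem_range_self (hI.1 h), hI.2]

theorem filter_powersetCard_range {m n N : ℕ} (hn : n ≤ N) :
    ((range N).powersetCard m).filter (· ⊆ range n) = (range n).powersetCard m := by
  ext I
  simp only [mem_filter, mem_powersetCard]
  exact ⟨fun h => ⟨h.2, h.1.2⟩, fun h => ⟨⟨h.1.trans (range_mono hn), h.2⟩, h.1⟩⟩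

end finsets

/-! ### Degenerate families -/

section families

variable {B S Y : Type*} [NormedAddCommGroup B]

/-- The increments of the partial sums of a degenerate family. -/
def increment (f : Finset ℕ → (ℕ → S) × Y → B) (m N k : ℕ) (z : (ℕ → S) × Y) : B :=
  if k < N then ∑ I ∈ (Finset.range k).powersetCard m, f (insert k I) z else 0

theorem sum_increment {f : Finset ℕ → (ℕ → S) × Y → B} {m N n : ℕ} (hn : n ≤ N) (z : (ℕ → S) × Y) :
    ∑ k ∈ Finset.range n, increment f m N k z =
      ∑ I ∈ (Finset.range n).powersetCard (m + 1), f I z := by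
  rw [sum_powersetCard_succ_range]
  refine Finset.sum_congr rfl fun k hk => ?_
  rw [increment, if_pos ((Finset.mem_range.1 hk).trans_le hn)]

variable [MeasurableSpace Y]

/-- The maximum over `n ≤ N` of the `p`-th powers of the norms of the sums over the `I` contained
in `{0, …, n - 1}`. -/
noncomputable def maxStat (p : ℝ) (ν : Measure Y) (f : Finset ℕ → (ℕ → S) × Y → B) (m N : ℕ)
    (x : ℕ → S) : ℝ≥0∞ :=
  (Finset.range (N + 1)).sup fun n =>
    pInt p ν fun y => ∑ I ∈ (Finset.range n).powersetCard m, f I (x, y)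

variable {ν : Measure Y} {p : ℝ} {f : Finset ℕ → (ℕ → S) × Y → B} {m N : ℕ}

theorem pInt_le_maxStat {n : ℕ} (hn : n ≤ N) (x : ℕ → S) :
    (pInt p ν fun y => ∑ I ∈ (Finset.range n).powersetCard m, f I (x, y)) ≤
      maxStat p ν f m N x :=
  Finset.le_sup (f := fun n => pInt p ν fun y =>
    ∑ I ∈ (Finset.range n).powersetCard m, f I (x, y)) (Finset.mem_range.2 (by omega))

theorem maxSum_increment (x : ℕ → S) :
    maxSum p ν (increment f m N) N x = maxStat p ν f (m + 1) N x := by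
  refine Finset.sup_congr rfl fun n hn => ?_
  congr 1
  funext y
  exact sum_increment (Nat.lt_succ_iff.1 (Finset.mem_range.1 hn)) (x, y)

variable [MeasurableSpace S]

/-- The sum of the conditional `p`-th moments of the `f I`, `A ⊆ I`, given the coordinates
in `A`. -/
noncomputable def condVar (μ : Measure S) (p : ℝ) (ν : Measure Y)
    (f : Finset ℕ → (ℕ → S) × Y → B) (m N : ℕ) (A : Finset ℕ) (x : ℕ → S) : ℝ≥0∞ :=
  ∑ I ∈ (Finset.range N).powersetCard m,
    if A ⊆ I then ∫⁻ w, pInt p ν (fun y => f I (splice A x w, y)) ∂iidLaw ℕ μ else 0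

end families

section degenerate

variable {B S Y : Type*} [NormedAddCommGroup B] [MeasurableSpace B] [MeasurableSpace S]
  [MeasurableSpace Y] {μ : Measure S} {ν : Measure Y} {p : ℝ} {f : Finset ℕ → (ℕ → S) × Y → B}
  {m N : ℕ}

/-- A family of functions `f I`, where `f I (x, y)` depends on the coordinates of `x` in `I` and
on a parameter `y`, which is centred in each of the coordinates in `I`. -/
structure IsDegenerateFamily [NormedSpace ℝ B] (μ : Measure S) (ν : Measure Y)
    (f : Finset ℕ → (ℕ → S) × Y → B) (m N : ℕ) : Prop where
  measurable : ∀ I, Measurable (f I)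
  dependsOn : ∀ I ∈ (Finset.range N).powersetCard m, ∀ x x' y,
    (∀ i ∈ I, x i = x' i) → f I (x, y) = f I (x', y)
  integral_eq_zero : ∀ I ∈ (Finset.range N).powersetCard m, ∀ k ∈ I,
    ∀ᵐ z ∂(iidLaw ℕ μ).prod ν, ∫ w, f I (splice {k}ᶜ z.1 w, z.2) ∂iidLaw ℕ μ = 0

/-- The cutoff at `N` in `increment` makes this true for every `k`, as the maximal inequality asks,
although the family is controlled only on subsets of `range N`. -/
theorem increment_dependsOn [NormedSpace ℝ B]
    (hf : IsDegenerateFamily μ ν f (m + 1) N) (k : ℕ) (x x' : ℕ → S) (y : Y)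
    (h : ∀ i ≤ k, x i = x' i) : increment f m N k (x, y) = increment f m N k (x', y) := by
  unfold increment
  split_ifs with hk
  · refine Finset.sum_congr rfl fun I hI =>
      hf.dependsOn _ (insert_mem_powersetCard_range hI hk) x x' y fun i hi => h i ?_
    rcases Finset.mem_insert.1 hi with rfl | hi
    · exact le_rfl
    · exact (Finset.mem_range.1 ((Finset.mem_powersetCard.1 hI).1 hi)).le
  · rfl

variable [BorelSpace B] [SecondCountableTopology B]

theorem measurable_increment (hf : ∀ I, Measurable (f I)) (k : ℕ) :
    Measurable (increment f m N k) := by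
  unfold increment
  split_ifs <;> fun_prop

theorem increment_lintegral_ne_top [NormedSpace ℝ B] (hp : 1 ≤ p)
    (hf : IsDegenerateFamily μ ν f (m + 1) N)
    (hfin : ∀ I ∈ (Finset.range N).powersetCard (m + 1),
      ∫⁻ z, ‖f I z‖ₑ ^ p ∂(iidLaw ℕ μ).prod ν ≠ ∞) {k : ℕ} (hk : k < N) :
    ∫⁻ z, ‖increment f m N k z‖ₑ ^ p ∂(iidLaw ℕ μ).prod ν ≠ ∞ := by
  have hp0 : 0 < p := by linarith
  have h1 : ∀ g : (ℕ → S) × Y → B, ∫⁻ z, ‖g z‖ₑ ^ p ∂(iidLaw ℕ μ).prod ν < ∞ ↔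
      eLpNorm g (ENNReal.ofReal p) ((iidLaw ℕ μ).prod ν) < ∞ := fun g => by
    rw [eLpNorm_lt_top_iff_lintegral_rpow_enorm_lt_top (by simpa using hp0) ENNReal.ofReal_ne_top,
      ENNReal.toReal_ofReal hp0.le]
  have h2 : MemLp (fun z => ∑ I ∈ (Finset.range k).powersetCard m, f (insert k I) z)
      (ENNReal.ofReal p) ((iidLaw ℕ μ).prod ν) := by
    refine memLp_finsetSum _ fun I hI => ⟨(hf.measurable _).aestronglyMeasurable, ?_⟩
    exact (h1 _).1 (hfin _ (insert_mem_powersetCard_range hI hk)).lt_top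
  simp only [increment, if_pos hk]
  exact ((h1 _).2 h2.2).ne

variable [IsProbabilityMeasure μ] [SFinite ν]

theorem measurable_lintegral_pInt_splice (hf : ∀ I, Measurable (f I)) (A : Set ℕ) (I : Finset ℕ) :
    Measurable fun x => ∫⁻ w, pInt p ν (fun y => f I (splice A x w, y)) ∂iidLaw ℕ μ := by
  refine Measurable.lintegral_prod_right' (f := fun z : (ℕ → S) × (ℕ → S) =>
    pInt p ν fun y => f I (splice A z.1 z.2, y)) ?_
  exact measurable_pInt (F := fun z : ((ℕ → S) × (ℕ → S)) × Y =>
    f I (splice A z.1.1 z.1.2, z.2)) (by fun_prop)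

theorem measurable_condVar (hf : ∀ I, Measurable (f I)) (A : Finset ℕ) :
    Measurable (condVar μ p ν f m N A) := by
  refine Finset.measurable_sum _ fun I _ => ?_
  split_ifs
  · exact measurable_lintegral_pInt_splice hf A I
  · exact measurable_const

theorem increment_integral_eq_zero [NormedSpace ℝ B] (hp : 1 ≤ p)
    (hf : IsDegenerateFamily μ ν f (m + 1) N)
    (hfin : ∀ I ∈ (Finset.range N).powersetCard (m + 1),
      ∫⁻ z, ‖f I z‖ₑ ^ p ∂(iidLaw ℕ μ).prod ν ≠ ∞) {k : ℕ} (hk : k < N) :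
    ∀ᵐ z ∂(iidLaw ℕ μ).prod ν,
      ∫ w, increment f m N k (splice {k}ᶜ z.1 w, z.2) ∂iidLaw ℕ μ = 0 := by
  have h1 : ∀ᵐ z ∂(iidLaw ℕ μ).prod ν, ∀ I ∈ (Finset.range k).powersetCard m,
      ∫ w, f (insert k I) (splice {k}ᶜ z.1 w, z.2) ∂iidLaw ℕ μ = 0 ∧
        Integrable (fun w => f (insert k I) (splice {k}ᶜ z.1 w, z.2)) (iidLaw ℕ μ) := by
    rw [Finset.eventually_all]
    intro I hI
    have hI' := insert_mem_powersetCard_range hI hk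
    exact (hf.integral_eq_zero _ hI' k (Finset.mem_insert_self k I)).and
      (ae_integrable_splice hp _ (hf.measurable _) (hfin _ hI'))
  filter_upwards [h1] with z hz
  simp only [increment, if_pos hk]
  rw [integral_finsetSum _ fun I hI => (hz I hI).2]
  exact Finset.sum_eq_zero fun I hI => (hz I hI).1

end degenerate

/-! ### Reduction of the order of a degenerate family -/

section reduction

variable {B S Y : Type*} [NormedAddCommGroup B] [MeasurableSpace S] [MeasurableSpace Y]
  {μ : Measure S} {ν : Measure Y} {p κ : ℝ}
  {f : Finset ℕ → (ℕ → S) × Y → B} {m n N : ℕ}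

/-- The family of lower order obtained by freezing the coordinate `n`. -/
noncomputable def freeze (f : Finset ℕ → (ℕ → S) × Y → B) (n : ℕ) (w : ℕ → S) (I : Finset ℕ)
    (z : (ℕ → S) × Y) : B :=
  f (insert n I) (splice {n}ᶜ z.1 w, z.2)

/-- Freezing `n` and then conditioning on `A` amounts to conditioning on `insert n A`; only the sets
with maximum `n` occur on the left. -/
theorem condVar_freeze_le (hn : n < N) {A : Finset ℕ} (hA : A ⊆ Finset.range n) (w x : ℕ → S) :
    condVar μ p ν (freeze f n w) m n A x ≤
      condVar μ p ν f (m + 1) N (insert n A) (splice {n}ᶜ x w) := by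
  have hnA : n ∉ A := fun h => Finset.notMem_range_self (hA h)
  have e : ∀ w', splice {n}ᶜ (splice A x w') w =
      splice (insert n A : Finset ℕ) (splice {n}ᶜ x w) w' := by
    intro w'
    funext i
    by_cases hi : i = n
    · subst hi
      rw [splice_compl_singleton_self, splice_of_mem (by simp), splice_compl_singleton_self]
    · rw [splice_compl_singleton_of_ne hi]
      by_cases hiA : i ∈ A
      · rw [splice_of_mem (by simpa using hiA), splice_of_mem (by simp [hiA]),
          splice_compl_singleton_of_ne hi]
      · rw [splice_of_notMem (by simpa using hiA), splice_of_notMem (by simp [hi, hiA])]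
  rw [condVar, condVar, sum_powersetCard_succ_range]
  refine le_trans (Finset.sum_le_sum fun I _ => ?_)
    (Finset.single_le_sum (f := fun n' => ∑ I ∈ (Finset.range n').powersetCard m,
      if insert n A ⊆ insert n' I then ∫⁻ w', pInt p ν (fun y => f (insert n' I)
        (splice (insert n A : Finset ℕ) (splice {n}ᶜ x w) w', y)) ∂iidLaw ℕ μ else 0)
      (fun _ _ => zero_le) (Finset.mem_range.2 hn))
  by_cases hAI : A ⊆ I
  · rw [if_pos hAI, if_pos (Finset.insert_subset_insert n hAI)]
    simp only [freeze, e]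
    exact le_rfl
  · rw [if_neg hAI]; exact zero_le

/-- The family of lower order obtained by replacing the largest coordinate by an independent
copy, which becomes part of the parameter. -/
noncomputable def resample (f : Finset ℕ → (ℕ → S) × Y → B) (N : ℕ) (I : Finset ℕ)
    (z : (ℕ → S) × (ℕ × (Y × (ℕ → S)))) : B :=
  if z.2.1 < N ∧ I ⊆ Finset.range z.2.1 then
    f (insert z.2.1 I) (splice {z.2.1}ᶜ z.1 z.2.2.2, z.2.2.1) else 0

variable [MeasurableSpace B]

theorem measurable_resample (hf : ∀ I, Measurable (f I)) (I : Finset ℕ) :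
    Measurable (resample f N I) := by
  have h : Measurable fun z : ℕ × ((ℕ → S) × (Y × (ℕ → S))) =>
      resample f N I (z.2.1, (z.1, z.2.2)) := by
    refine measurable_from_prod_countable_right fun n => ?_
    simp only [resample]
    split_ifs <;> fun_prop
  exact h.comp (by fun_prop : Measurable fun z : (ℕ → S) × (ℕ × (Y × (ℕ → S))) =>
    (z.2.1, (z.1, z.2.2)))

variable [IsProbabilityMeasure μ] [SFinite ν]

/-- Replacing coordinate `n` commutes with integrating out a coordinate `k ≠ n`, so centring
survives for almost every frozen value, by Fubini. -/
theorem IsDegenerateFamily.ae_freeze [NormedSpace ℝ B]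
    (hf : IsDegenerateFamily μ ν f (m + 1) N) (hn : n < N) :
    ∀ᵐ w ∂iidLaw ℕ μ, IsDegenerateFamily μ ν (freeze f n w) m n := by
  have h : ∀ᵐ w ∂iidLaw ℕ μ, ∀ I ∈ (Finset.range n).powersetCard m, ∀ k ∈ I,
      ∀ᵐ z ∂(iidLaw ℕ μ).prod ν,
        ∫ w', freeze f n w I (splice {k}ᶜ z.1 w', z.2) ∂iidLaw ℕ μ = 0 := by
    rw [Finset.eventually_all]
    intro I hI
    rw [Finset.eventually_all]
    intro k hk
    have hkn : k ≠ n := by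
      rintro rfl
      exact Finset.notMem_range_self ((Finset.mem_powersetCard.1 hI).1 hk)
    have h1 := ae_rearrange_left (ae_splice_prod μ {n}ᶜ ν
      (hf.integral_eq_zero _ (insert_mem_powersetCard_range hI hn) k (Finset.mem_insert_of_mem hk)))
    filter_upwards [h1] with w hw
    filter_upwards [hw] with z hz
    simp only [freeze, splice_compl_singleton_comm hkn]
    exact hz
  filter_upwards [h] with w hw
  refine ⟨fun I => ?_, fun I hI x x' y hxx' => ?_, hw⟩
  · have := hf.measurable (insert n I)
    unfold freeze
    fun_prop
  · refine hf.dependsOn _ (insert_mem_powersetCard_range hI hn) _ _ y fun i hi => ?_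
    by_cases hin : i = n
    · subst hin; rw [splice_compl_singleton_self, splice_compl_singleton_self]
    · rw [splice_compl_singleton_of_ne hin, splice_compl_singleton_of_ne hin]
      exact hxx' i ((Finset.mem_insert.1 hi).resolve_left hin)

variable [BorelSpace B] [SecondCountableTopology B]

/-- Counting measure turns a sum of `p`-th powers of norms into the `p`-th power of a single `L^p`
norm. -/
theorem pInt_prod_count {X : Type*} [MeasurableSpace X] {Q : Measure X} [SFinite Q]
    (hp : 0 < p) {g : ℕ → Y × X → B} (hg : ∀ n, Measurable (g n))
    (h0 : ∀ n, N ≤ n → g n = 0) :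
    pInt p ((Measure.count : Measure ℕ).prod (ν.prod Q)) (fun y => g y.1 y.2) =
      ∑ n ∈ Finset.range N, ∫⁻ w, pInt p ν (fun y => g n (y, w)) ∂Q := by
  have hm : Measurable fun y : ℕ × (Y × X) => g y.1 y.2 :=
    measurable_from_prod_countable_right hg
  rw [pInt, lintegral_prod _ (by fun_prop), lintegral_count, tsum_eq_sum (s := Finset.range N)]
  · refine Finset.sum_congr rfl fun n _ => ?_
    have := hg n
    rw [lintegral_prod_symm _ (by fun_prop)]
    rfl
  · intro n hn
    simp [h0 n (by simpa using hn), ENNReal.zero_rpow_of_pos hp]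

/-- The predictable variation is exactly the last of the quantities whose maximum is taken on the
right. -/
theorem maxStat_resample_ge (hp : 0 < p) (hf : ∀ I, Measurable (f I)) (x : ℕ → S) :
    ∑ k ∈ Finset.range N, predVar μ p ν (increment f m N) k x ≤
      maxStat p ((Measure.count : Measure ℕ).prod (ν.prod (iidLaw ℕ μ))) (resample f N) m N x := by
  refine le_trans (le_of_eq ?_) (pInt_le_maxStat le_rfl x)
  have hm : ∀ n, Measurable fun y : Y × (ℕ → S) =>
      ∑ I ∈ (Finset.range N).powersetCard m, resample f N I (x, (n, y)) := fun n =>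
    Finset.measurable_sum _ fun I _ => (measurable_resample hf I).comp (by fun_prop)
  rw [pInt_prod_count (N := N) (g := fun n y =>
    ∑ I ∈ (Finset.range N).powersetCard m, resample f N I (x, (n, y))) hp hm]
  · refine Finset.sum_congr rfl fun n hn => ?_
    rw [Finset.mem_range] at hn
    refine lintegral_congr fun w => ?_
    congr 1
    funext y
    simp only [increment, resample, hn, if_true, true_and]
    rw [← Finset.sum_filter, filter_powersetCard_range hn.le]
  · intro n hn
    funext y
    refine Finset.sum_eq_zero fun I _ => ?_
    rw [resample, if_neg (by simp; omega)]

/-- If `A ⊆ I` and `n` lies above `I`, then `n ∉ A`, so the copy of coordinate `n` in the parameter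
merges with the average over the coordinates off `A`. What results is the part of the right side
where the maximum of the set is not in `A`. -/
theorem condVar_resample_le (hp : 0 < p) (hf : ∀ I, Measurable (f I)) (A : Finset ℕ)
    (x : ℕ → S) :
    condVar μ p ((Measure.count : Measure ℕ).prod (ν.prod (iidLaw ℕ μ))) (resample f N) m N A x ≤
      condVar μ p ν f (m + 1) N A x := by
  have hm : ∀ (x : ℕ → S) (I : Finset ℕ) (n : ℕ), Measurable fun y : Y × (ℕ → S) =>
      resample f N I (x, (n, y)) := fun x I n => (measurable_resample hf I).comp (by fun_prop)
  have key : ∀ I, A ⊆ I →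
      ∫⁻ w, pInt p ((Measure.count : Measure ℕ).prod (ν.prod (iidLaw ℕ μ)))
        (fun y => resample f N I (splice A x w, y)) ∂iidLaw ℕ μ =
      ∑ n ∈ Finset.range N, if I ⊆ Finset.range n then
        ∫⁻ w, pInt p ν (fun y => f (insert n I) (splice A x w, y)) ∂iidLaw ℕ μ else 0 := by
    intro I hAI
    have h1 : ∀ w, pInt p ((Measure.count : Measure ℕ).prod (ν.prod (iidLaw ℕ μ)))
        (fun y => resample f N I (splice A x w, y)) =
        ∑ n ∈ Finset.range N, ∫⁻ w', pInt p ν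
          (fun y => resample f N I (splice A x w, (n, (y, w')))) ∂iidLaw ℕ μ := by
      intro w
      refine pInt_prod_count (g := fun n y => resample f N I (splice A x w, (n, y))) hp
        (hm _ I) fun n hn => ?_
      funext y
      rw [resample, if_neg (by simp; omega)]
      rfl
    simp only [h1]
    rw [lintegral_finsetSum]
    · refine Finset.sum_congr rfl fun n hn => ?_
      rw [Finset.mem_range] at hn
      split_ifs with hI
      · have hnA : n ∉ A := fun h => Finset.notMem_range_self (hI (hAI h))
        have e : ∀ w w', splice {n}ᶜ (splice A x w) w' = splice A x (splice {n}ᶜ w w') := by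
          intro w w'
          funext i
          by_cases hi : i = n
          · subst hi
            rw [splice_compl_singleton_self, splice_of_notMem (by simpa using hnA),
              splice_compl_singleton_self]
          · rw [splice_compl_singleton_of_ne hi]
            by_cases hiA : i ∈ (A : Set ℕ)
            · rw [splice_of_mem hiA, splice_of_mem hiA]
            · rw [splice_of_notMem hiA, splice_of_notMem hiA, splice_compl_singleton_of_ne hi]
        simp only [resample, hn, hI, and_self, if_true, e]
        refine lintegral_splice μ {n}ᶜ (F := fun w => pInt p ν
          fun y => f (insert n I) (splice A x w, y)) ?_
        exact measurable_pInt (F := fun z : (ℕ → S) × Y =>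
          f (insert n I) (splice A x z.1, z.2)) (by fun_prop)
      · simp [resample, hI, pInt_zero hp]
    · intro n _
      refine Measurable.lintegral_prod_right' (f := fun z : (ℕ → S) × (ℕ → S) =>
        pInt p ν fun y => resample f N I (splice A x z.1, (n, (y, z.2)))) ?_
      exact measurable_pInt (F := fun z : ((ℕ → S) × (ℕ → S)) × Y =>
        resample f N I (splice A x z.1.1, (n, (z.2, z.1.2))))
        ((measurable_resample hf I).comp (by fun_prop))
  calc condVar μ p ((Measure.count : Measure ℕ).prod (ν.prod (iidLaw ℕ μ)))
        (resample f N) m N A x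
      = ∑ I ∈ (Finset.range N).powersetCard m, ∑ n ∈ Finset.range N,
          if I ⊆ Finset.range n then if A ⊆ I then
            ∫⁻ w, pInt p ν (fun y => f (insert n I) (splice A x w, y)) ∂iidLaw ℕ μ else 0
          else 0 := by
        refine Finset.sum_congr rfl fun I _ => ?_
        split_ifs with hAI
        · exact key I hAI
        · simp
    _ = ∑ n ∈ Finset.range N, ∑ I ∈ (Finset.range n).powersetCard m, if A ⊆ I then
          ∫⁻ w, pInt p ν (fun y => f (insert n I) (splice A x w, y)) ∂iidLaw ℕ μ else 0 := by
        rw [Finset.sum_comm]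
        refine Finset.sum_congr rfl fun n hn => ?_
        rw [← Finset.sum_filter, filter_powersetCard_range (Finset.mem_range.1 hn).le]
    _ ≤ condVar μ p ν f (m + 1) N A x := by
        rw [condVar, sum_powersetCard_succ_range]
        refine Finset.sum_le_sum fun n _ => Finset.sum_le_sum fun I _ => ?_
        by_cases hAI : A ⊆ I
        · rw [if_pos hAI, if_pos (hAI.trans (Finset.subset_insert n I))]
        · rw [if_neg hAI]; exact zero_le

variable [NormedSpace ℝ B]

/-- As for `freeze`, resampling `n` commutes with integrating out `k ≠ n`. The null sets are handled
for each of the countably many `n` and then reassembled. -/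
theorem IsDegenerateFamily.resample (hf : IsDegenerateFamily μ ν f (m + 1) N) :
    IsDegenerateFamily μ ((Measure.count : Measure ℕ).prod (ν.prod (iidLaw ℕ μ)))
      (resample f N) m N := by
  refine ⟨measurable_resample hf.measurable, fun I hI x x' y hxx' => ?_, fun I hI k hk => ?_⟩
  · unfold UStat.resample
    split_ifs with h
    · have hI' := insert_mem_powersetCard_range
        (Finset.mem_powersetCard.2 ⟨h.2, (Finset.mem_powersetCard.1 hI).2⟩) h.1
      refine hf.dependsOn _ hI' _ _ _ fun i hi => ?_
      by_cases hin : i = y.1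
      · subst hin; rw [splice_compl_singleton_self, splice_compl_singleton_self]
      · rw [splice_compl_singleton_of_ne hin, splice_compl_singleton_of_ne hin]
        exact hxx' i ((Finset.mem_insert.1 hi).resolve_left hin)
    · rfl
  · have hm : Measurable fun z : ((ℕ → S) × (ℕ × (Y × (ℕ → S)))) × (ℕ → S) =>
        UStat.resample f N I (splice {k}ᶜ z.1.1 z.2, z.1.2) :=
      (measurable_resample hf.measurable I).comp (by fun_prop)
    have hset : MeasurableSet {z : (ℕ → S) × (ℕ × (Y × (ℕ → S))) |
        ∫ w, UStat.resample f N I (splice {k}ᶜ z.1 w, z.2) ∂iidLaw ℕ μ = 0} :=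
      measurableSet_eq_fun (hm.stronglyMeasurable.integral_prod_right').measurable measurable_const
    rw [Measure.ae_prod_iff_ae_ae hset]
    have h1 : ∀ n, ∀ᵐ x ∂iidLaw ℕ μ, ∀ᵐ r ∂ν.prod (iidLaw ℕ μ),
        ∫ w, UStat.resample f N I (splice {k}ᶜ x w, (n, r)) ∂iidLaw ℕ μ = 0 := by
      intro n
      by_cases h : n < N ∧ I ⊆ Finset.range n
      · have hkn : k ≠ n := by
          rintro rfl
          exact Finset.notMem_range_self (h.2 hk)
        have hI' := insert_mem_powersetCard_range
          (Finset.mem_powersetCard.2 ⟨h.2, (Finset.mem_powersetCard.1 hI).2⟩) h.1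
        have h2 := Measure.ae_ae_of_ae_prod (ae_rearrange_right (ae_splice_prod μ {n}ᶜ ν
          (hf.integral_eq_zero _ hI' k (Finset.mem_insert_of_mem hk))))
        filter_upwards [h2] with x hx
        filter_upwards [hx] with r hr
        simp only [UStat.resample, h, and_self, if_true, splice_compl_singleton_comm hkn]
        exact hr
      · simp [UStat.resample, h]
    rw [← ae_all_iff] at h1
    filter_upwards [h1] with x hx
    have hset' : MeasurableSet {y : ℕ × (Y × (ℕ → S)) |
        ∫ w, UStat.resample f N I (splice {k}ᶜ x w, y) ∂iidLaw ℕ μ = 0} :=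
      measurable_prodMk_left hset
    rw [Measure.ae_prod_iff_ae_ae hset']
    exact Filter.Eventually.of_forall hx

end reduction

/-! ### Truncated moments of degenerate families -/

section main

variable {B : Type*} [NormedAddCommGroup B] [NormedSpace ℝ B] [SecondCountableTopology B]
  [MeasurableSpace B] [BorelSpace B]

/-- For almost every value of coordinate `n` the increment is the full sum of a frozen family of
order `m`; the assumed bound is applied to it and integrated over that value. -/
theorem lintegral_trunc_increment_le {S Y : Type*} [MeasurableSpace S] {μ : Measure S}
    [IsProbabilityMeasure μ] [MeasurableSpace Y] {ν : Measure Y} [SFinite ν] {p κ : ℝ} (hκ : 0 < κ)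
    {K : ℝ≥0∞} {f : Finset ℕ → (ℕ → S) × Y → B} {m n N : ℕ}
    (hK : ∀ g : Finset ℕ → (ℕ → S) × Y → B, IsDegenerateFamily μ ν g m n →
      ∫⁻ x, trunc κ (maxStat p ν g m n x) ∂iidLaw ℕ μ ≤
        K * ∑ A ∈ (Finset.range n).powerset, ∫⁻ x, trunc κ (condVar μ p ν g m n A x) ∂iidLaw ℕ μ)
    (hf : IsDegenerateFamily μ ν f (m + 1) N) (hn : n < N) :
    ∫⁻ x, trunc κ (pInt p ν fun y => increment f m N n (x, y)) ∂iidLaw ℕ μ ≤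
      K * ∑ A ∈ (Finset.range n).powerset,
        ∫⁻ x, trunc κ (condVar μ p ν f (m + 1) N (insert n A) x) ∂iidLaw ℕ μ := by
  have hfm := hf.measurable
  have swap : ∀ F : (ℕ → S) → ℝ≥0∞, Measurable F → ∫⁻ x, F x ∂iidLaw ℕ μ =
      ∫⁻ w, ∫⁻ x, F (splice {n}ᶜ x w) ∂iidLaw ℕ μ ∂iidLaw ℕ μ := by
    intro F hF
    rw [← lintegral_splice μ {n}ᶜ hF, lintegral_lintegral_swap]
    exact (by fun_prop : Measurable fun z : (ℕ → S) × (ℕ → S) =>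
      F (splice {n}ᶜ z.1 z.2)).aemeasurable
  have hV : ∀ A, Measurable fun x => trunc κ (condVar μ p ν f (m + 1) N A x) := fun A =>
    measurable_trunc (measurable_condVar hfm A)
  rw [swap _ (measurable_trunc (measurable_pInt (measurable_increment hfm n))),
    Finset.sum_congr rfl fun A _ => swap _ (hV (insert n A))]
  have hV' : ∀ A, Measurable fun w => ∫⁻ x,
      trunc κ (condVar μ p ν f (m + 1) N (insert n A) (splice {n}ᶜ x w)) ∂iidLaw ℕ μ := fun A =>
    Measurable.lintegral_prod_left' (f := fun z : (ℕ → S) × (ℕ → S) =>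
      trunc κ (condVar μ p ν f (m + 1) N (insert n A) (splice {n}ᶜ z.1 z.2)))
      ((hV (insert n A)).comp (by fun_prop))
  rw [← lintegral_finsetSum _ fun A _ => hV' A,
    ← lintegral_const_mul _ (Finset.measurable_sum _ fun A _ => hV' A)]
  refine lintegral_mono_ae ?_
  filter_upwards [hf.ae_freeze hn] with w hw
  refine le_trans (lintegral_mono fun x => trunc_mono hκ ?_) ((hK _ hw).trans ?_)
  · refine le_trans (le_of_eq ?_) (pInt_le_maxStat le_rfl x)
    congr 1
    funext y
    rw [increment, if_pos hn]
    rfl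
  · gcongr with A hA
    exact trunc_mono hκ (condVar_freeze_le hn (Finset.mem_powerset.1 hA) w _)

/-- The truncated moments of the sums of a degenerate family of order `m` are controlled by those
of the conditional `p`-th moments. -/
theorem exists_lintegral_trunc_maxStat_le [CompleteSpace B] {p : ℝ} (hp : 1 ≤ p)
    {ψ : Seminorm ℝ B} {C : ℝ≥0} (hψ : IsTwoPointNorm p ψ C) {κ : ℝ} (hκ : 0 < κ) (m : ℕ) :
    ∃ K : ℝ≥0, ∀ (S : Type v) [MeasurableSpace S] (μ : Measure S) [IsProbabilityMeasure μ]
      (Y : Type v) [MeasurableSpace Y] (ν : Measure Y) [SFinite ν]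
      (f : Finset ℕ → (ℕ → S) × Y → B) (N : ℕ) (_ : IsDegenerateFamily μ ν f m N),
      ∫⁻ x, trunc κ (maxStat p ν f m N x) ∂iidLaw ℕ μ ≤
        K * ∑ A ∈ (Finset.range N).powerset,
          ∫⁻ x, trunc κ (condVar μ p ν f m N A x) ∂iidLaw ℕ μ := by
  have hp0 : 0 < p := by linarith
  induction m with
  | zero =>
    refine ⟨1, fun S _ μ _ Y _ ν _ f N hf => ?_⟩
    rw [ENNReal.coe_one, one_mul]
    refine le_trans (lintegral_mono fun x => trunc_mono hκ ?_)
      (Finset.single_le_sum (f := fun A => ∫⁻ x, trunc κ (condVar μ p ν f 0 N A x) ∂iidLaw ℕ μ)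
        (fun _ _ => zero_le) (Finset.empty_mem_powerset _))
    refine Finset.sup_le fun n _ => ?_
    simp only [condVar, Finset.powersetCard_zero, Finset.sum_singleton, Finset.empty_subset,
      if_true, Finset.coe_empty]
    have h1 : ∀ w, (pInt p ν fun y => f ∅ (splice ∅ x w, y)) = pInt p ν fun y => f ∅ (x, y) := by
      intro w
      congr 1
      funext y
      exact hf.dependsOn ∅ (by simp) _ _ y (by simp)
    simp only [h1, lintegral_const, measure_univ, mul_one]
    exact le_rfl
  | succ m ih =>
    obtain ⟨K₁, hK₁⟩ := exists_lintegral_trunc_maxSum_le.{v} hp hψ hκ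
    obtain ⟨K₂, hK₂⟩ := ih
    -- The two `K₂` serve the increments and the predictable variation. The `1` covers families with
    -- an infinite `p`-th moment: there the term `A = ∅` equals `1`, which bounds the left side
    -- trivially.
    refine ⟨1 + K₁ * (K₂ + K₂), fun S _ μ _ Y _ ν _ f N hf => ?_⟩
    set c : Finset ℕ → ℝ≥0∞ := fun A =>
      ∫⁻ x, trunc κ (condVar μ p ν f (m + 1) N A x) ∂iidLaw ℕ μ with hc
    by_cases hfin : ∀ I ∈ (Finset.range N).powersetCard (m + 1),
        ∫⁻ z, ‖f I z‖ₑ ^ p ∂(iidLaw ℕ μ).prod ν ≠ ∞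
    · have h0 := hK₁ S μ Y ν (increment f m N) (measurable_increment hf.measurable)
        (increment_dependsOn hf) N (fun k hk => increment_integral_eq_zero hp hf hfin hk)
        fun k hk => increment_lintegral_ne_top hp hf hfin hk
      simp only [maxSum_increment] at h0
      have h1 : ∑ n ∈ Finset.range N,
          ∫⁻ x, trunc κ (pInt p ν fun y => increment f m N n (x, y)) ∂iidLaw ℕ μ ≤
          K₂ * ∑ A ∈ (Finset.range N).powerset, c A := by
        -- The sets `insert n A` with `A ⊆ range n` run through the nonempty subsets once each,
        -- sorted by their maximum.
        rw [sum_powerset_range, mul_add, Finset.mul_sum]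
        refine le_trans (Finset.sum_le_sum fun n hn => ?_) le_add_self
        exact lintegral_trunc_increment_le hκ (fun g hg => hK₂ S μ Y ν g n hg) hf
          (Finset.mem_range.1 hn)
      have h2 : ∫⁻ x, trunc κ (∑ k ∈ Finset.range N, predVar μ p ν (increment f m N) k x)
          ∂iidLaw ℕ μ ≤ K₂ * ∑ A ∈ (Finset.range N).powerset, c A := by
        refine le_trans (lintegral_mono fun x =>
          trunc_mono hκ (maxStat_resample_ge hp0 hf.measurable x)) ?_
        refine (hK₂ S μ _ _ _ N hf.resample).trans ?_
        gcongr with A hA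
        exact lintegral_mono fun x =>
          trunc_mono hκ (condVar_resample_le hp0 hf.measurable A x)
      calc _ ≤ K₁ * (K₂ * ∑ A ∈ (Finset.range N).powerset, c A +
            K₂ * ∑ A ∈ (Finset.range N).powerset, c A) := h0.trans (by gcongr)
        _ = (K₁ * (K₂ + K₂)) * ∑ A ∈ (Finset.range N).powerset, c A := by ring
        _ ≤ _ := by
          push_cast
          gcongr
          exact le_add_self
    · push Not at hfin
      obtain ⟨I, hI, hIfin⟩ := hfin
      have h1 : ∀ x, condVar μ p ν f (m + 1) N ∅ x = ∞ := by
        intro x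
        rw [eq_top_iff, condVar]
        refine le_trans ?_ (Finset.single_le_sum (f := fun I => if ∅ ⊆ I then
          ∫⁻ w, pInt p ν (fun y => f I (splice (∅ : Finset ℕ) x w, y)) ∂iidLaw ℕ μ else 0)
          (fun _ _ => zero_le) hI)
        simp only [Finset.empty_subset, if_true, Finset.coe_empty, splice_empty]
        rw [lintegral_pInt (hf.measurable I), hIfin]
      have h2 : c ∅ = 1 := by
        simp only [hc, h1, trunc_of_one_le le_top, lintegral_one, measure_univ]
      calc _ ≤ ∫⁻ _, 1 ∂iidLaw ℕ μ := lintegral_mono fun x => trunc_le_one hκ _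
        _ = 1 * c ∅ := by rw [h2]; simp
        _ ≤ _ := by
          push_cast
          gcongr
          · exact le_self_add
          · exact Finset.single_le_sum (fun _ _ => zero_le) (Finset.empty_mem_powerset _)

end main

/-! ### Conditional expectations of functions of independent variables -/

/-- The family with the coordinates `z` on `J` and those of `v` off `J`. -/
def glue {ι S : Type*} [DecidableEq ι] (J : Finset ι) (z : J → S) (v : ι → S) : ι → S :=
  fun i => if h : i ∈ J then z ⟨i, h⟩ else v i

section glue

variable {ι S : Type*}

/-- `glue` receives only the coordinates in `J`, which shows measurability for their `σ`-algebra;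
`splice` obeys the resampling formula. -/
theorem glue_restrict [DecidableEq ι] (J : Finset ι) (u v : ι → S) :
    glue J (fun j => u j) v = splice J u v := by
  funext i
  by_cases h : i ∈ J
  · rw [splice_of_mem (by simpa using h), glue, dif_pos h]
  · rw [splice_of_notMem (by simpa using h), glue, dif_neg h]

variable [MeasurableSpace S]

theorem measurePreserving_comp_injective (μ : Measure S) [IsProbabilityMeasure μ] {α : Type*}
    {a : α → ι} (ha : Function.Injective a) :
    MeasurePreserving (fun (x : ι → S) i => x (a i)) (iidLaw ι μ) (iidLaw α μ) :=
  ⟨by fun_prop, Measure.map_infinitePi_infinitePi_of_inj ha⟩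

variable [DecidableEq ι]

@[fun_prop]
theorem measurable_glue {Z : Type*} [MeasurableSpace Z] (J : Finset ι) {f : Z → J → S}
    {g : Z → ι → S} (hf : Measurable f) (hg : Measurable g) :
    Measurable fun z => glue J (f z) (g z) := by
  refine measurable_pi_iff.2 fun i => ?_
  by_cases h : i ∈ J
  · simp only [glue, dif_pos h]; fun_prop
  · simp only [glue, dif_neg h]; fun_prop

theorem measurable_lintegral_glue {μ : Measure S} [IsProbabilityMeasure μ] (J : Finset ι)
    {F : (ι → S) → ℝ≥0∞} (hF : Measurable F) :
    Measurable fun z : J → S => ∫⁻ v, F (glue J z v) ∂iidLaw ι μ :=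
  Measurable.lintegral_prod_right' (f := fun z : (J → S) × (ι → S) => F (glue J z.1 z.2))
    (by fun_prop)

end glue

section iid

variable {Ω S : Type*} [MeasurableSpace Ω] [MeasurableSpace S] {ξ : ℕ → Ω → S} {P : Measure Ω}

theorem IsIID.measurePreserving (hξ : IsIID ξ P) :
    MeasurePreserving (fun ω i => ξ i ω) P (iidLaw ℕ (P.map (ξ 0))) := by
  refine ⟨measurable_pi_iff.2 hξ.measurable, ?_⟩
  rw [hξ.indep.map_fun_eq_infinitePi_map hξ.measurable]
  congr 1
  funext i
  exact (hξ.identDistrib i).map_eq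

variable [IsProbabilityMeasure P]

theorem IsIID.isProbabilityMeasure_map (hξ : IsIID ξ P) : IsProbabilityMeasure (P.map (ξ 0)) :=
  Measure.isProbabilityMeasure_map (hξ.measurable 0).aemeasurable

theorem IsIID.measurePreserving_firstTerms (hξ : IsIID ξ P) (m : ℕ) :
    MeasurePreserving (firstTerms m ξ) P (iidLaw (Fin m) (P.map (ξ 0))) := by
  have := hξ.isProbabilityMeasure_map
  exact (measurePreserving_comp_injective (P.map (ξ 0)) Fin.val_injective).comp
    hξ.measurePreserving

theorem IsIID.measurePreserving_restrict (hξ : IsIID ξ P) {m : ℕ} (J : Finset (Fin m)) :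
    MeasurePreserving (fun ω (j : J) => firstTerms m ξ ω j) P (iidLaw J (P.map (ξ 0))) := by
  have := hξ.isProbabilityMeasure_map
  exact (measurePreserving_comp_injective (P.map (ξ 0)) Subtype.val_injective).comp
    (hξ.measurePreserving_firstTerms m)

theorem IsIID.sigmaAlg_le (hξ : IsIID ξ P) {m : ℕ} (J : Finset (Fin m)) :
    sigmaAlg ξ J ≤ (inferInstance : MeasurableSpace Ω) :=
  (hξ.measurePreserving_restrict J).measurable.comap_le

/-- An event of the `σ`-algebra of `J` is unaffected by resampling off `J`, so its indicator passes
through `lintegral_splice`; this is the defining property of the conditional expectation. -/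
theorem IsIID.condLExp_eq (hξ : IsIID ξ P) {m : ℕ} (J : Finset (Fin m))
    {F : (Fin m → S) → ℝ≥0∞} (hF : Measurable F) :
    condLExp (sigmaAlg ξ J) P (fun ω => F (firstTerms m ξ ω)) =ᵐ[P]
      fun ω => ∫⁻ v, F (glue J (fun j => firstTerms m ξ ω j) v)
        ∂iidLaw (Fin m) (P.map (ξ 0)) := by
  have := hξ.isProbabilityMeasure_map
  have hX := hξ.measurePreserving_firstTerms m
  symm
  refine ae_eq_condLExp (hξ.sigmaAlg_le J) P _ ?_ ?_
  · exact (measurable_lintegral_glue J hF).comp (comap_measurable _)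
  · rintro _ ⟨E, hE, rfl⟩
    have hE' : MeasurableSet {u : Fin m → S | (fun j : J => u j) ∈ E} :=
      (by fun_prop : Measurable fun (u : Fin m → S) (j : J) => u j) hE
    have hset : (fun ω (j : J) => firstTerms m ξ ω j) ⁻¹' E =
      firstTerms m ξ ⁻¹' {u | (fun j : J => u j) ∈ E} := rfl
    simp only [glue_restrict]
    have hm : Measurable fun u : Fin m → S =>
        ∫⁻ v, F (splice J u v) ∂iidLaw (Fin m) (P.map (ξ 0)) :=
      Measurable.lintegral_prod_right' (f := fun z : (Fin m → S) × (Fin m → S) =>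
        F (splice J z.1 z.2)) (by fun_prop)
    rw [hset, hX.setLIntegral_comp_preimage hE' hm, hX.setLIntegral_comp_preimage hE' hF,
      ← lintegral_indicator hE', ← lintegral_indicator hE',
      ← lintegral_splice (P.map (ξ 0)) (J : Set (Fin m)) (hF.indicator hE')]
    refine lintegral_congr fun u => ?_
    have hs : ∀ v, splice J u v ∈ {u : Fin m → S | (fun j : J => u j) ∈ E} ↔
        u ∈ {u : Fin m → S | (fun j : J => u j) ∈ E} := by
      intro v
      have : (fun j : J => splice J u v j) = fun j : J => u j :=
        funext fun j => splice_of_mem (by simp)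
      simp only [Set.mem_ofPred_eq, this]
    by_cases hu : u ∈ {u : Fin m → S | (fun j : J => u j) ∈ E}
    · rw [Set.indicator_of_mem hu]
      exact lintegral_congr fun v => (Set.indicator_of_mem ((hs v).2 hu) F).symm
    · rw [Set.indicator_of_notMem hu]
      simp only [Set.indicator_of_notMem fun h => hu ((hs _).1 h), lintegral_zero]

variable {B : Type*} [NormedAddCommGroup B] [NormedSpace ℝ B]

theorem integral_splice {ι : Type*} (μ : Measure S) [IsProbabilityMeasure μ] (A : Set ι)
    {g : (ι → S) → B} (hg : Integrable g (iidLaw ι μ)) :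
    ∫ x, ∫ w, g (splice A x w) ∂iidLaw ι μ ∂iidLaw ι μ = ∫ x, g x ∂iidLaw ι μ := by
  have hmp := measurePreserving_splice μ A
  have h := integral_prod _ (hmp.integrable_comp_of_integrable hg)
  have h2 := integral_map hmp.measurable.aemeasurable (f := g)
    (by rw [hmp.map_eq]; exact hg.aestronglyMeasurable)
  rw [hmp.map_eq] at h2
  exact h.symm.trans h2.symm

variable [CompleteSpace B] [SecondCountableTopology B] [MeasurableSpace B] [BorelSpace B]

theorem IsIID.condExp_eq (hξ : IsIID ξ P) {m : ℕ} (J : Finset (Fin m))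
    {g : (Fin m → S) → B} (hg : Measurable g)
    (hgi : Integrable (fun ω => g (firstTerms m ξ ω)) P) :
    P[fun ω => g (firstTerms m ξ ω) | sigmaAlg ξ J] =ᵐ[P]
      fun ω => ∫ v, g (splice J (firstTerms m ξ ω) v) ∂iidLaw (Fin m) (P.map (ξ 0)) := by
  have := hξ.isProbabilityMeasure_map
  have hX := hξ.measurePreserving_firstTerms m
  set Q := iidLaw (Fin m) (P.map (ξ 0)) with hQ
  have hgQ : Integrable g Q := (hX.integrable_comp hg.aestronglyMeasurable).1 hgi
  have hm : Measurable fun u : Fin m → S => ∫ v, g (splice J u v) ∂Q :=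
    ((by fun_prop : Measurable fun z : (Fin m → S) × (Fin m → S) =>
      g (splice J z.1 z.2)).stronglyMeasurable.integral_prod_right').measurable
  have hmi : Integrable (fun u : Fin m → S => ∫ v, g (splice J u v) ∂Q) Q :=
    ((measurePreserving_splice (P.map (ξ 0)) (J : Set (Fin m))).integrable_comp_of_integrable
      hgQ).integral_prod_left
  symm
  refine ae_eq_condExp_of_forall_setIntegral_eq (hξ.sigmaAlg_le J) hgi ?_ ?_ ?_
  · exact fun s _ _ => (hX.integrable_comp_of_integrable hmi).integrableOn
  · rintro _ ⟨E, hE, rfl⟩ -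
    have hE' : MeasurableSet {u : Fin m → S | (fun j : J => u j) ∈ E} :=
      (by fun_prop : Measurable fun (u : Fin m → S) (j : J) => u j) hE
    have hset : (fun ω (j : J) => firstTerms m ξ ω j) ⁻¹' E =
      firstTerms m ξ ⁻¹' {u | (fun j : J => u j) ∈ E} := rfl
    have tr : ∀ G : (Fin m → S) → B, Measurable G →
        ∫ ω in firstTerms m ξ ⁻¹' {u | (fun j : J => u j) ∈ E}, G (firstTerms m ξ ω) ∂P =
          ∫ u, {u : Fin m → S | (fun j : J => u j) ∈ E}.indicator G u ∂Q := by
      intro G hG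
      rw [integral_indicator hE', ← hX.map_eq, setIntegral_map hE' hG.aestronglyMeasurable
        hX.measurable.aemeasurable]
    rw [hset, tr _ hm, tr _ hg, ← integral_splice (P.map (ξ 0)) (J : Set (Fin m))
      (hgQ.indicator hE')]
    refine integral_congr_ae (Filter.Eventually.of_forall fun u => ?_)
    have hs : ∀ v, splice J u v ∈ {u : Fin m → S | (fun j : J => u j) ∈ E} ↔
        u ∈ {u : Fin m → S | (fun j : J => u j) ∈ E} := by
      intro v
      have : (fun j : J => splice J u v j) = fun j : J => u j :=
        funext fun j => splice_of_mem (by simp)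
      simp only [Set.mem_ofPred_eq, this]
    simp only
    by_cases hu : u ∈ {u : Fin m → S | (fun j : J => u j) ∈ E}
    · rw [Set.indicator_of_mem hu]
      exact integral_congr_ae (Filter.Eventually.of_forall fun v =>
        (Set.indicator_of_mem ((hs v).2 hu) g).symm)
    · rw [Set.indicator_of_notMem hu]
      simp only [Set.indicator_of_notMem fun h => hu ((hs _).1 h), integral_zero]
  · have h1 : (fun ω => ∫ v, g (splice J (firstTerms m ξ ω) v) ∂Q) =
        (fun z : J → S => ∫ v, g (glue J z v) ∂Q) ∘ fun ω (j : J) => firstTerms m ξ ω j := by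
      funext ω
      simp only [Function.comp, glue_restrict]
    rw [h1]
    have h2 : StronglyMeasurable fun z : J → S => ∫ v, g (glue J z v) ∂Q :=
      (by fun_prop : Measurable fun z : (J → S) × (Fin m → S) =>
        g (glue J z.1 z.2)).stronglyMeasurable.integral_prod_right'
    exact (h2.comp_measurable (comap_measurable _)).aestronglyMeasurable

/-- A degenerate kernel is centred in each of its arguments. -/
theorem IsDegenerate.ae_integral_splice_eq_zero (hξ : IsIID ξ P) {m : ℕ} {g : (Fin m → S) → B}
    (hg : Measurable g) (hd : IsDegenerate g ξ P) (l : Fin m) :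
    ∀ᵐ u ∂iidLaw (Fin m) (P.map (ξ 0)),
      ∫ v, g (splice {l}ᶜ u v) ∂iidLaw (Fin m) (P.map (ξ 0)) = 0 := by
  have := hξ.isProbabilityMeasure_map
  have hX := hξ.measurePreserving_firstTerms m
  have hm : Measurable fun u : Fin m → S =>
      ∫ v, g (splice {l}ᶜ u v) ∂iidLaw (Fin m) (P.map (ξ 0)) :=
    ((by fun_prop : Measurable fun z : (Fin m → S) × (Fin m → S) =>
      g (splice {l}ᶜ z.1 z.2)).stronglyMeasurable.integral_prod_right').measurable
  rw [← hX.map_eq, ae_map_iff hX.measurable.aemeasurable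
    (by rw [hX.map_eq]; exact measurableSet_eq_fun hm measurable_const), hX.map_eq]
  filter_upwards [hξ.condExp_eq (Finset.univ.erase l) hg hd.integrable, hd.condExp_eq_zero l]
    with ω h1 h2
  rw [h1] at h2
  simpa [Finset.coe_erase, Set.compl_eq_univ_sdiff] using h2

end iid

/-! ### Increasing tuples and finite sets -/

section index

variable {m n N : ℕ}

theorem mem_inc {i : Fin m → ℕ} : i ∈ inc m n ↔ (∀ l, i l < n) ∧ StrictMono i := by
  simp [inc, Fintype.mem_piFinset]

/-- The increasing enumeration of a set with `m` elements. -/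
noncomputable def enum (m : ℕ) (I : Finset ℕ) : Fin m → ℕ :=
  if h : I.card = m then I.orderEmbOfFin h else fun l => l

/-- The default value of `enum` is itself increasing, so no condition on `I` is needed and
`kernelFamily` is measurable at every `I`. -/
theorem enum_strictMono (I : Finset ℕ) : StrictMono (enum m I) := by
  unfold enum
  split_ifs with h
  · exact (I.orderEmbOfFin h).strictMono
  · exact Fin.val_strictMono

theorem enum_mem {I : Finset ℕ} (h : I.card = m) (l : Fin m) : enum m I l ∈ I := by
  rw [enum, dif_pos h]
  exact Finset.orderEmbOfFin_mem I h l

theorem image_enum {I : Finset ℕ} (h : I.card = m) : Finset.univ.image (enum m I) = I := by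
  rw [enum, dif_pos h, Finset.image_orderEmbOfFin_univ]

theorem enum_image {i : Fin m → ℕ} (hi : StrictMono i) : enum m (Finset.univ.image i) = i := by
  have h : (Finset.univ.image i).card = m := by
    rw [Finset.card_image_of_injective _ hi.injective, Finset.card_univ, Fintype.card_fin]
  rw [enum, dif_pos h]
  exact (Finset.orderEmbOfFin_unique h (fun l => Finset.mem_image_of_mem i (Finset.mem_univ l))
    hi).symm

theorem sum_inc {M : Type*} [AddCommMonoid M] (F : (Fin m → ℕ) → M) :
    ∑ i ∈ inc m n, F i = ∑ I ∈ (Finset.range n).powersetCard m, F (enum m I) := by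
  refine Finset.sum_nbij' (fun i => Finset.univ.image i) (enum m) ?_ ?_ ?_ ?_ ?_
  · intro i hi
    rw [mem_inc] at hi
    rw [Finset.mem_powersetCard]
    constructor
    · intro k hk
      obtain ⟨l, -, rfl⟩ := Finset.mem_image.1 hk
      exact Finset.mem_range.2 (hi.1 l)
    · rw [Finset.card_image_of_injective _ hi.2.injective, Finset.card_univ, Fintype.card_fin]
  · intro I hI
    rw [Finset.mem_powersetCard] at hI
    refine mem_inc.2 ⟨fun l => Finset.mem_range.1 (hI.1 (enum_mem hI.2 l)), enum_strictMono I⟩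
  · exact fun i hi => enum_image (mem_inc.1 hi).2
  · exact fun I hI => image_enum (Finset.mem_powersetCard.1 hI).2
  · intro i hi
    rw [enum_image (mem_inc.1 hi).2]

/-- The pairs of a set `J` of positions and of values in `{0, …, N - 1}` at these positions. -/
def sites (m N : ℕ) : Finset (Σ J : Finset (Fin m), J → ℕ) :=
  Finset.univ.sigma fun _ => Fintype.piFinset fun _ => Finset.range N

/-- There are `2 ^ m` sets of positions, and on each at most `(m + 1) ^ m` maps into `A`, which has
at most `m` elements if any site exists. The bound does not involve `N`. -/
theorem card_filter_sites_le (A : Finset ℕ) :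
    ((sites m N).filter fun s => Finset.univ.image s.2 = A).card ≤ 2 ^ m * (m + 1) ^ m := by
  classical
  rcases ((sites m N).filter fun s => Finset.univ.image s.2 = A).eq_empty_or_nonempty with h | h
  · rw [h]; simp
  have hJ : ∀ J : Finset (Fin m), J.card ≤ m := fun J => by
    simpa using Finset.card_le_univ J
  have hA : A.card ≤ m := by
    obtain ⟨s, hs⟩ := h
    rw [← (Finset.mem_filter.1 hs).2]
    refine Finset.card_image_le.trans ?_
    simpa using hJ s.1
  have hsub : ((sites m N).filter fun s => Finset.univ.image s.2 = A) ⊆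
      Finset.univ.sigma fun J : Finset (Fin m) => Fintype.piFinset fun _ : J => A := by
    intro s hs
    rw [Finset.mem_sigma, Fintype.mem_piFinset]
    refine ⟨Finset.mem_univ _, fun j => ?_⟩
    rw [← (Finset.mem_filter.1 hs).2]
    exact Finset.mem_image_of_mem _ (Finset.mem_univ j)
  refine (Finset.card_le_card hsub).trans ?_
  rw [Finset.card_sigma]
  refine (Finset.sum_le_card_nsmul _ _ ((m + 1) ^ m) fun J _ => ?_).trans ?_
  · rw [Fintype.card_piFinset, Finset.prod_const, Finset.card_univ, Fintype.card_coe]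
    exact (Nat.pow_le_pow_left (by omega) _).trans (Nat.pow_le_pow_right (by omega) (hJ J))
  · simp

end index

/-! ### Families of kernels -/

section kernels

variable {B S : Type*} [NormedAddCommGroup B] {m N : ℕ}

/-- The family indexed by finite sets that is given by a family of kernels. -/
noncomputable def kernelFamily [NormedSpace ℝ B] (m : ℕ) (c : ℝ)
    (h : (Fin m → ℕ) → (Fin m → S) → B) (I : Finset ℕ) (z : (ℕ → S) × PUnit.{v + 1}) : B :=
  c • h (enum m I) fun l => z.1 (enum m I l)

theorem pInt_kernelFamily [NormedSpace ℝ B] {p c : ℝ} (hp : 0 ≤ p)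
    {h : (Fin m → ℕ) → (Fin m → S) → B} (I : Finset ℕ) (x : ℕ → S) :
    pInt p (Measure.dirac PUnit.unit) (fun y => kernelFamily.{v} m c h I (x, y)) =
      ‖c‖ₑ ^ p * ‖h (enum m I) fun l => x (enum m I l)‖ₑ ^ p := by
  rw [pInt, lintegral_dirac, kernelFamily, enorm_smul, ENNReal.mul_rpow_of_nonneg _ _ hp]

variable [MeasurableSpace S]

/-- The conditional `p`-th moment of the kernel `h i` given the arguments at the positions in
`J`, summed over all `i` with prescribed indices at these positions. -/
noncomputable def condSum (μ : Measure S) (p : ℝ) (h : (Fin m → ℕ) → (Fin m → S) → B) (N : ℕ)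
    (J : Finset (Fin m)) (a : J → ℕ) (z : J → S) : ℝ≥0∞ :=
  ∑ i ∈ inc m N with ∀ j : J, i j = a j, ∫⁻ v, ‖h i (glue J z v)‖ₑ ^ p ∂iidLaw (Fin m) μ

variable [MeasurableSpace B] [BorelSpace B] [SecondCountableTopology B]

theorem measurable_condSum {μ : Measure S} [IsProbabilityMeasure μ] {p : ℝ}
    {h : (Fin m → ℕ) → (Fin m → S) → B} (hh : ∀ i, StrictMono i → Measurable (h i))
    (J : Finset (Fin m)) (a : J → ℕ) : Measurable (condSum μ p h N J a) := by
  refine Finset.measurable_sum _ fun i hi =>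
    measurable_lintegral_glue J (F := fun u => ‖h i u‖ₑ ^ p) ?_
  have := hh i (mem_inc.1 (Finset.mem_filter.1 hi).1).2
  fun_prop

/-- For injective `a` the selected coordinates are again independent with law `μ`. Otherwise no
increasing tuple extends `a`, and the sum is empty. -/
theorem lintegral_trunc_condSum_le {μ : Measure S} [IsProbabilityMeasure μ] {p κ : ℝ}
    (hκ : 0 < κ) {γ : ℝ≥0∞} {h : (Fin m → ℕ) → (Fin m → S) → B}
    (hh : ∀ i, StrictMono i → Measurable (h i)) (J : Finset (Fin m)) (a : J → ℕ) :
    ∫⁻ x, trunc κ (γ * condSum μ p h N J a fun j => x (a j)) ∂iidLaw ℕ μ ≤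
      ∫⁻ z, trunc κ (γ * condSum μ p h N J a z) ∂iidLaw J μ := by
  by_cases ha : Function.Injective a
  · rw [← (measurePreserving_comp_injective μ ha).lintegral_comp
      (measurable_trunc ((measurable_condSum hh J a).const_mul γ))]
  · have h0 : ∀ z, condSum μ p h N J a z = 0 := by
      intro z
      refine Finset.sum_eq_zero fun i hi => absurd ?_ ha
      rw [Finset.mem_filter, mem_inc] at hi
      intro j j' hjj
      rw [← hi.2 j, ← hi.2 j'] at hjj
      exact Subtype.ext (hi.1.2.injective hjj)
    simp [h0, trunc_zero hκ]

variable [NormedSpace ℝ B]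

/-- A tuple `i` whose range contains `A` belongs to the site with `J = {l | i l ∈ A}` and values `i`
on `J`; conditioning on `A` then fixes exactly the arguments at `J`. -/
theorem condVar_kernelFamily_le {μ : Measure S} [IsProbabilityMeasure μ] {p c : ℝ} (hp : 0 < p)
    {h : (Fin m → ℕ) → (Fin m → S) → B} (hh : ∀ i, StrictMono i → Measurable (h i))
    (A : Finset ℕ) (x : ℕ → S) :
    condVar μ p (Measure.dirac PUnit.unit) (kernelFamily.{v} m c h) m N A x ≤
      ∑ s ∈ sites m N with Finset.univ.image s.2 = A,
        ‖c‖ₑ ^ p * condSum μ p h N s.1 s.2 fun j => x (s.2 j) := by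
  classical
  set F : (Fin m → ℕ) → ℝ≥0∞ := fun i => if A ⊆ Finset.univ.image i then
    ∫⁻ w, ‖c‖ₑ ^ p * ‖h i fun l => splice A x w (i l)‖ₑ ^ p ∂iidLaw ℕ μ else 0 with hF
  have e1 : condVar μ p (Measure.dirac PUnit.unit) (kernelFamily.{v} m c h) m N A x =
      ∑ i ∈ inc m N, F i := by
    rw [sum_inc, condVar]
    refine Finset.sum_congr rfl fun I hI => ?_
    simp only [hF, image_enum (Finset.mem_powersetCard.1 hI).2, pInt_kernelFamily hp.le]
  rw [e1]
  simp only [condSum, Finset.sum_filter (s := inc m N), Finset.mul_sum]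
  rw [Finset.sum_comm]
  refine Finset.sum_le_sum fun i hi => ?_
  by_cases hA : A ⊆ Finset.univ.image i
  swap
  · simp only [hF, if_neg hA]; exact zero_le
  rw [mem_inc] at hi
  set J : Finset (Fin m) := Finset.univ.filter fun l => i l ∈ A with hJ
  have hs : (⟨J, fun j => i j⟩ : Σ J : Finset (Fin m), J → ℕ) ∈
      (sites m N).filter fun s => Finset.univ.image s.2 = A := by
    rw [Finset.mem_filter, sites, Finset.mem_sigma, Fintype.mem_piFinset]
    refine ⟨⟨Finset.mem_univ _, fun j => Finset.mem_range.2 (hi.1 j)⟩, ?_⟩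
    ext k
    simp only [Finset.mem_image, Finset.mem_univ, true_and]
    constructor
    · rintro ⟨j, rfl⟩
      exact (Finset.mem_filter.1 j.2).2
    · intro hk
      obtain ⟨l, -, rfl⟩ := Finset.mem_image.1 (hA hk)
      exact ⟨⟨l, by simp [hJ, hk]⟩, rfl⟩
  refine le_trans (le_of_eq ?_) (Finset.single_le_sum
    (f := fun s : Σ J : Finset (Fin m), J → ℕ => ‖c‖ₑ ^ p * if ∀ j : s.1, i j = s.2 j then
      ∫⁻ v, ‖h i (glue s.1 (fun j => x (s.2 j)) v)‖ₑ ^ p ∂iidLaw (Fin m) μ else 0)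
    (fun _ _ => zero_le) hs)
  have e2 : ∀ w, (fun l => splice A x w (i l)) = glue J (fun j => x (i j)) fun l => w (i l) := by
    intro w
    funext l
    by_cases hl : i l ∈ A
    · rw [splice_of_mem (by simpa using hl), glue, dif_pos (by simp [hJ, hl])]
    · rw [splice_of_notMem (by simpa using hl), glue, dif_neg (by simp [hJ, hl])]
  have hhi := hh i hi.2
  have hm : Measurable fun v => ‖h i (glue J (fun j => x (i j)) v)‖ₑ ^ p := by fun_prop
  simp only [hF, if_pos hA, implies_true, if_true, e2]
  rw [lintegral_const_mul _ (by fun_prop), ← (measurePreserving_comp_injective μ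
    hi.2.injective).lintegral_comp hm]

theorem sum_lintegral_trunc_condVar_le {μ : Measure S} [IsProbabilityMeasure μ] {p κ c : ℝ}
    (hp : 0 < p) (hκ : 0 < κ) {h : (Fin m → ℕ) → (Fin m → S) → B}
    (hh : ∀ i, StrictMono i → Measurable (h i)) :
    ∑ A ∈ (Finset.range N).powerset, ∫⁻ x, trunc κ
        (condVar μ p (Measure.dirac PUnit.unit) (kernelFamily.{v} m c h) m N A x) ∂iidLaw ℕ μ ≤
      ((2 ^ m * (m + 1) ^ m : ℕ) : ℝ≥0∞) ^ κ * ∑ J : Finset (Fin m),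
        ∑ a ∈ Fintype.piFinset fun _ : J => Finset.range N,
          ∫⁻ z, trunc κ (‖c‖ₑ ^ p * condSum μ p h N J a z) ∂iidLaw J μ := by
  classical
  set L : (Σ J : Finset (Fin m), J → ℕ) → ℝ≥0∞ := fun s =>
    ∫⁻ z, trunc κ (‖c‖ₑ ^ p * condSum μ p h N s.1 s.2 z) ∂iidLaw s.1 μ with hL
  have hm : ∀ s : Σ J : Finset (Fin m), J → ℕ, Measurable fun x : ℕ → S =>
      trunc κ (‖c‖ₑ ^ p * condSum μ p h N s.1 s.2 fun j => x (s.2 j)) := fun s =>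
    measurable_trunc (((measurable_condSum hh s.1 s.2).comp
      (by fun_prop : Measurable fun (x : ℕ → S) j => x (s.2 j))).const_mul _)
  have h1 : ∀ A ∈ (Finset.range N).powerset, ∫⁻ x, trunc κ
      (condVar μ p (Measure.dirac PUnit.unit) (kernelFamily.{v} m c h) m N A x) ∂iidLaw ℕ μ ≤
      ((2 ^ m * (m + 1) ^ m : ℕ) : ℝ≥0∞) ^ κ *
        ∑ s ∈ sites m N with Finset.univ.image s.2 = A, L s := by
    intro A _
    calc _ ≤ ∫⁻ x, ((2 ^ m * (m + 1) ^ m : ℕ) : ℝ≥0∞) ^ κ *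
          ∑ s ∈ sites m N with Finset.univ.image s.2 = A,
            trunc κ (‖c‖ₑ ^ p * condSum μ p h N s.1 s.2 fun j => x (s.2 j)) ∂iidLaw ℕ μ := by
          refine lintegral_mono fun x => ?_
          refine (trunc_mono hκ (condVar_kernelFamily_le hp hh A x)).trans
            ((trunc_sum_le hκ _ _).trans ?_)
          gcongr
          exact card_filter_sites_le A
      _ = ((2 ^ m * (m + 1) ^ m : ℕ) : ℝ≥0∞) ^ κ *
          ∑ s ∈ sites m N with Finset.univ.image s.2 = A, ∫⁻ x,
            trunc κ (‖c‖ₑ ^ p * condSum μ p h N s.1 s.2 fun j => x (s.2 j)) ∂iidLaw ℕ μ := by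
          rw [lintegral_const_mul _ (Finset.measurable_sum _ fun s _ => hm s),
            lintegral_finsetSum _ fun s _ => hm s]
      _ ≤ _ := by
          gcongr with s hs
          exact lintegral_trunc_condSum_le hκ hh s.1 s.2
  refine (Finset.sum_le_sum h1).trans ?_
  rw [← Finset.mul_sum, Finset.sum_fiberwise_of_maps_to (t := (Finset.range N).powerset)
    (g := fun s : Σ J : Finset (Fin m), J → ℕ => Finset.univ.image s.2) ?_ L, sites,
    Finset.sum_sigma]
  intro s hs
  rw [sites, Finset.mem_sigma, Fintype.mem_piFinset] at hs
  rw [Finset.mem_powerset]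
  intro k hk
  obtain ⟨j, -, rfl⟩ := Finset.mem_image.1 hk
  exact hs.2 j

end kernels

/-! ### Transfer to independent sequences -/

section transfer

variable {Ω B : Type*} {S : Type v} [MeasurableSpace Ω] [MeasurableSpace S]
  [NormedAddCommGroup B] [NormedSpace ℝ B] [SecondCountableTopology B] [MeasurableSpace B]
  [BorelSpace B] {ξ : ℕ → Ω → S} {P : Measure Ω} {m : ℕ} {h : (Fin m → ℕ) → (Fin m → S) → B}

/-- Markov's inequality: after scaling by `t⁻¹` the level is `1`, where the truncated power equals
`1`. The parameter space is a single point. -/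
theorem measure_lt_sup_uStat_le (hξ : IsIID ξ P) (hh : ∀ i, StrictMono i → Measurable (h i))
    {p κ : ℝ} (hp : 0 < p) {t : ℝ} (ht : 0 < t) (N : ℕ) :
    P {ω | t < (((Finset.Icc m N).sup fun n => ‖uStat h ξ n ω‖₊ : ℝ≥0) : ℝ)} ≤
      ∫⁻ x, trunc κ (maxStat p (Measure.dirac PUnit.unit) (kernelFamily.{v} m t⁻¹ h) m N x)
        ∂iidLaw ℕ (P.map (ξ 0)) := by
  have hkm : ∀ I, Measurable (kernelFamily.{v} m t⁻¹ h I) := by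
    intro I
    have := hh _ (enum_strictMono (m := m) I)
    unfold kernelFamily
    fun_prop
  have hmax : Measurable fun x => trunc κ
      (maxStat p (Measure.dirac PUnit.unit) (kernelFamily.{v} m t⁻¹ h) m N x) := by
    refine measurable_trunc ?_
    have e : maxStat p (Measure.dirac PUnit.unit) (kernelFamily.{v} m t⁻¹ h) m N = fun x =>
        ⨆ n ∈ Finset.range (N + 1), pInt p (Measure.dirac PUnit.unit) fun y =>
          ∑ I ∈ (Finset.range n).powersetCard m, kernelFamily.{v} m t⁻¹ h I (x, y) := by
      funext x; rw [maxStat, Finset.sup_eq_iSup]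
    rw [e]
    exact Measurable.iSup fun n => Measurable.iSup fun _ => measurable_pInt
      (F := fun z => ∑ I ∈ (Finset.range n).powersetCard m, kernelFamily.{v} m t⁻¹ h I z)
      (by fun_prop)
  rw [← hξ.measurePreserving.lintegral_comp hmax]
  refine le_trans (measure_mono ?_) ((one_mul _).symm.trans_le (mul_meas_ge_le_lintegral
    (hmax.comp hξ.measurePreserving.measurable) 1))
  intro ω hω
  have hω' : t.toNNReal < (Finset.Icc m N).sup fun n => ‖uStat h ξ n ω‖₊ := by
    rw [← NNReal.coe_lt_coe, Real.coe_toNNReal _ ht.le]; exact hω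
  obtain ⟨n, hn, hlt⟩ := (Finset.lt_sup_iff).1 hω'
  rw [← NNReal.coe_lt_coe, Real.coe_toNNReal _ ht.le, coe_nnnorm] at hlt
  refine (trunc_of_one_le ?_).ge
  refine le_trans ?_ (pInt_le_maxStat (Finset.mem_Icc.1 hn).2 _)
  have e : (∑ I ∈ (Finset.range n).powersetCard m,
      kernelFamily.{v} m t⁻¹ h I (fun i => ξ i ω, PUnit.unit)) = t⁻¹ • uStat h ξ n ω := by
    simp only [kernelFamily, uStat, sum_inc, Finset.smul_sum]
  rw [pInt, lintegral_dirac, e]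
  refine ENNReal.one_le_rpow ?_ hp
  rw [← ofReal_norm, ENNReal.one_le_ofReal, norm_smul, Real.norm_of_nonneg (by positivity),
    inv_mul_eq_div, one_le_div ht]
  exact hlt.le

variable [CompleteSpace B] [IsProbabilityMeasure P]

theorem isDegenerateFamily_kernelFamily (hξ : IsIID ξ P)
    (hh : ∀ i, StrictMono i → Measurable (h i))
    (hd : ∀ i, StrictMono i → IsDegenerate (h i) ξ P) (c : ℝ) (N : ℕ) :
    IsDegenerateFamily (P.map (ξ 0)) (Measure.dirac PUnit.unit) (kernelFamily.{v} m c h) m N := by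
  have := hξ.isProbabilityMeasure_map
  refine ⟨fun I => ?_, fun I hI x x' y hxx' => ?_, fun I hI k hk => ?_⟩
  · have := hh _ (enum_strictMono (m := m) I)
    unfold kernelFamily
    fun_prop
  · have : (fun l => x (enum m I l)) = fun l => x' (enum m I l) :=
      funext fun l => hxx' _ (enum_mem (Finset.mem_powersetCard.1 hI).2 l)
    simp only [kernelFamily, this]
  · have hinj := (enum_strictMono (m := m) I).injective
    have hmeas := hh _ (enum_strictMono (m := m) I)
    rw [← image_enum (Finset.mem_powersetCard.1 hI).2] at hk
    obtain ⟨l, -, rfl⟩ := Finset.mem_image.1 hk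
    have hmp := measurePreserving_comp_injective (P.map (ξ 0)) hinj
    have h1 := hmp.quasiMeasurePreserving.ae
      ((hd _ (enum_strictMono I)).ae_integral_splice_eq_zero hξ hmeas l)
    filter_upwards [Measure.quasiMeasurePreserving_fst.ae h1] with z hz
    have e : ∀ w, (fun l' => splice {enum m I l}ᶜ z.1 w (enum m I l')) =
        splice {l}ᶜ (fun l' => z.1 (enum m I l')) fun l' => w (enum m I l') := by
      intro w
      funext l'
      by_cases hl : l' = l
      · subst hl; rw [splice_compl_singleton_self, splice_compl_singleton_self]
      · rw [splice_compl_singleton_of_ne hl, splice_compl_singleton_of_ne fun h => hl (hinj h)]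
    simp only [kernelFamily, e]
    rw [integral_smul, ← integral_map (f := fun v => h (enum m I)
      (splice {l}ᶜ (fun l' => z.1 (enum m I l')) v)) hmp.measurable.aemeasurable
      (Measurable.aestronglyMeasurable (by fun_prop)), hmp.map_eq, hz, smul_zero]

end transfer

/-! ### Identification of the terms of the bound -/

section terms

variable {Ω B S : Type*} [MeasurableSpace Ω] [MeasurableSpace S] [NormedAddCommGroup B]
  [SecondCountableTopology B] [MeasurableSpace B] [BorelSpace B] {ξ : ℕ → Ω → S} {P : Measure Ω}
  [IsProbabilityMeasure P] {m N : ℕ} {h : (Fin m → ℕ) → (Fin m → S) → B} {p q t : ℝ}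

theorem enorm_inv_rpow_mul (hp : 0 < p) (ht : 0 < t) (w : ℝ≥0∞) :
    ‖t⁻¹‖ₑ ^ p * w = (w ^ (1 / p) / ENNReal.ofReal t) ^ p := by
  rw [ENNReal.div_rpow_of_nonneg _ _ hp.le, ← ENNReal.rpow_mul, one_div_mul_cancel hp.ne',
    ENNReal.rpow_one, div_eq_mul_inv, mul_comm, Real.enorm_of_nonneg (by positivity),
    ENNReal.ofReal_inv_of_pos ht, ENNReal.inv_rpow]

/-- By independence the conditional moments are `condSum` at `ξ_J`. The exponent `q / p` on `p`-th
powers is `q` on their roots, so the layer-cake formula applies. -/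
theorem lintegral_trunc_condSum_eq (hξ : IsIID ξ P) (hh : ∀ i, StrictMono i → Measurable (h i))
    (hp : 0 < p) (hq : 0 < q) (ht : 0 < t) (J : Finset (Fin m)) (a : J → ℕ) :
    ∫⁻ z, trunc (q / p) (‖t⁻¹‖ₑ ^ p * condSum (P.map (ξ 0)) p h N J a z)
        ∂iidLaw J (P.map (ξ 0)) =
      ENNReal.ofReal q * tailIntegral P q t (condMomentRoot P h ξ p N J a) := by
  have := hξ.isProbabilityMeasure_map
  have hm : AEMeasurable (condMomentRoot P h ξ p N J a) P := by
    refine Measurable.aemeasurable (Measurable.pow_const ?_ _)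
    exact Finset.measurable_sum _ fun i _ => measurable_condLExp' _ _ _
  rw [← lintegral_trunc P hq ht hm, ← (hξ.measurePreserving_restrict J).lintegral_comp
    (measurable_trunc ((measurable_condSum hh J a).const_mul _))]
  have hae : ∀ᵐ ω ∂P, ∀ i ∈ (inc m N).filter fun i => ∀ j : J, i j = a j,
      condLExp (sigmaAlg ξ J) P (fun ω' => ‖h i (firstTerms m ξ ω')‖ₑ ^ p) ω =
        ∫⁻ v, ‖h i (glue J (fun j => firstTerms m ξ ω j) v)‖ₑ ^ p
          ∂iidLaw (Fin m) (P.map (ξ 0)) := by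
    rw [Finset.eventually_all]
    intro i hi
    have := hh i (mem_inc.1 (Finset.mem_filter.1 hi).1).2
    exact hξ.condLExp_eq J (F := fun u => ‖h i u‖ₑ ^ p) (by fun_prop)
  refine lintegral_congr_ae ?_
  filter_upwards [hae] with ω hω
  have e : condMomentRoot P h ξ p N J a ω =
      condSum (P.map (ξ 0)) p h N J a (fun j => firstTerms m ξ ω j) ^ (1 / p) := by
    rw [condMomentRoot, condSum, Finset.sum_congr rfl hω]
  rw [e, enorm_inv_rpow_mul hp ht, trunc_rpow hp, mul_div_cancel₀ _ hp.ne']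

/-- Fixing all positions leaves at most one tuple for each `a`, and nothing is averaged, so the
kernels themselves appear. -/
theorem sum_lintegral_trunc_condSum_univ_le (hξ : IsIID ξ P)
    (hh : ∀ i, StrictMono i → Measurable (h i)) (hp : 0 < p) (hq : 0 < q) (ht : 0 < t) :
    ∑ a ∈ Fintype.piFinset fun _ : (Finset.univ : Finset (Fin m)) => Finset.range N,
        ∫⁻ z, trunc (q / p) (‖t⁻¹‖ₑ ^ p * condSum (P.map (ξ 0)) p h N Finset.univ a z)
          ∂iidLaw (Finset.univ : Finset (Fin m)) (P.map (ξ 0)) ≤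
      ENNReal.ofReal q * ∑ i ∈ inc m N,
        tailIntegral P q t (fun ω => ‖h i (firstTerms m ξ ω)‖ₑ) := by
  have := hξ.isProbabilityMeasure_map
  have hκ : 0 < q / p := by positivity
  have hX := hξ.measurePreserving_firstTerms m
  have hterm : ∀ i ∈ inc m N, ∫⁻ ω, trunc (q / p) (‖t⁻¹‖ₑ ^ p * ‖h i (firstTerms m ξ ω)‖ₑ ^ p) ∂P =
      ENNReal.ofReal q * tailIntegral P q t (fun ω => ‖h i (firstTerms m ξ ω)‖ₑ) := by
    intro i hi
    have hm : Measurable fun ω => ‖h i (firstTerms m ξ ω)‖ₑ :=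
      ((hh i (mem_inc.1 hi).2).comp hX.measurable).enorm
    rw [← lintegral_trunc P hq ht hm.aemeasurable]
    refine lintegral_congr fun ω => ?_
    rw [enorm_inv_rpow_mul hp ht, ← ENNReal.rpow_mul, mul_one_div_cancel hp.ne', ENNReal.rpow_one,
      trunc_rpow hp, mul_div_cancel₀ _ hp.ne']
  rw [Finset.mul_sum, ← Finset.sum_congr rfl hterm]
  set s : (↥(Finset.univ : Finset (Fin m)) → ℕ) → Finset (Fin m → ℕ) := fun a =>
    (inc m N).filter fun i => (fun j : ↥(Finset.univ : Finset (Fin m)) => i j) = a with hs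
  rw [← Finset.sum_fiberwise_of_maps_to (s := inc m N)
    (t := Fintype.piFinset fun _ : (Finset.univ : Finset (Fin m)) => Finset.range N)
    (g := fun i j => i j)]
  swap
  · intro i hi
    rw [Fintype.mem_piFinset]
    exact fun j => Finset.mem_range.2 ((mem_inc.1 hi).1 j)
  refine Finset.sum_le_sum fun a _ => ?_
  rw [← (hξ.measurePreserving_restrict Finset.univ).lintegral_comp
    (measurable_trunc ((measurable_condSum hh Finset.univ a).const_mul _))]
  have hcard : (s a).card ≤ 1 := by
    rw [Finset.card_le_one]
    intro i hi i' hi'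
    have h1 := (Finset.mem_filter.1 hi).2.trans (Finset.mem_filter.1 hi').2.symm
    exact funext fun l => congrFun h1 ⟨l, Finset.mem_univ l⟩
  have hm : ∀ i ∈ s a, Measurable fun ω =>
      trunc (q / p) (‖t⁻¹‖ₑ ^ p * ‖h i (firstTerms m ξ ω)‖ₑ ^ p) := by
    intro i hi
    have := ((hh i (mem_inc.1 (Finset.mem_filter.1 hi).1).2).comp hX.measurable)
    exact measurable_trunc ((this.enorm.pow_const _).const_mul _)
  rw [← lintegral_finsetSum (s a) hm]
  refine lintegral_mono fun ω => ?_
  have e : condSum (P.map (ξ 0)) p h N Finset.univ a (fun j => firstTerms m ξ ω j) =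
      ∑ i ∈ s a, ‖h i (firstTerms m ξ ω)‖ₑ ^ p := by
    rw [condSum, hs]
    simp only [funext_iff]
    refine Finset.sum_congr rfl fun i _ => ?_
    have : ∀ v, glue Finset.univ (fun j => firstTerms m ξ ω j) v = firstTerms m ξ ω := fun v =>
      funext fun l => by rw [glue, dif_pos (Finset.mem_univ l)]
    simp [this]
  rw [e, Finset.mul_sum]
  refine (trunc_sum_le hκ _ _).trans ?_
  calc _ ≤ (1 : ℝ≥0∞) * ∑ i ∈ s a,
        trunc (q / p) (‖t⁻¹‖ₑ ^ p * ‖h i (firstTerms m ξ ω)‖ₑ ^ p) := by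
        gcongr
        exact ENNReal.rpow_le_one (by exact_mod_cast hcard) hκ.le
    _ = _ := one_mul _

/-- With no position fixed there is one `a` and the conditional moment is a constant; its truncated
power is at most its power. -/
theorem sum_lintegral_trunc_condSum_empty_le (hξ : IsIID ξ P)
    (hh : ∀ i, StrictMono i → Measurable (h i)) (hp : 0 < p) (hq : 0 < q) (ht : 0 < t) :
    ∑ a ∈ Fintype.piFinset fun _ : (∅ : Finset (Fin m)) => Finset.range N,
        ∫⁻ z, trunc (q / p) (‖t⁻¹‖ₑ ^ p * condSum (P.map (ξ 0)) p h N ∅ a z)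
          ∂iidLaw (∅ : Finset (Fin m)) (P.map (ξ 0)) ≤
      ENNReal.ofReal t ^ (-q) *
        (∑ i ∈ inc m N, ∫⁻ ω, ‖h i (firstTerms m ξ ω)‖ₑ ^ p ∂P) ^ (q / p) := by
  have := hξ.isProbabilityMeasure_map
  have hκ : 0 < q / p := by positivity
  have hX := hξ.measurePreserving_firstTerms m
  have hterm : ∀ a, ∫⁻ z, trunc (q / p) (‖t⁻¹‖ₑ ^ p * condSum (P.map (ξ 0)) p h N ∅ a z)
      ∂iidLaw (∅ : Finset (Fin m)) (P.map (ξ 0)) ≤ ENNReal.ofReal t ^ (-q) *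
        (∑ i ∈ inc m N, ∫⁻ ω, ‖h i (firstTerms m ξ ω)‖ₑ ^ p ∂P) ^ (q / p) := by
    intro a
    have e : ∀ z, condSum (P.map (ξ 0)) p h N ∅ a z =
        ∑ i ∈ inc m N, ∫⁻ ω, ‖h i (firstTerms m ξ ω)‖ₑ ^ p ∂P := by
      intro z
      have hg : ∀ v, glue ∅ z v = v := fun v => funext fun l => by simp [glue]
      rw [condSum, Finset.filter_true_of_mem fun i _ j => absurd j.2 (Finset.notMem_empty _)]
      refine Finset.sum_congr rfl fun i hi => ?_
      have hm := hh i (mem_inc.1 hi).2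
      simp only [hg]
      exact (hX.lintegral_comp (f := fun u => ‖h i u‖ₑ ^ p) (by fun_prop)).symm
    simp only [e, lintegral_const, measure_univ, mul_one]
    refine (trunc_le_rpow hκ _).trans (le_of_eq ?_)
    rw [ENNReal.mul_rpow_of_nonneg _ _ hκ.le, ← ENNReal.rpow_mul, mul_div_cancel₀ _ hp.ne',
      Real.enorm_of_nonneg (by positivity), ENNReal.ofReal_inv_of_pos ht, ENNReal.inv_rpow,
      ENNReal.rpow_neg]
  refine (Finset.sum_le_card_nsmul _ _ _ fun a _ => hterm a).trans (le_of_eq ?_)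
  rw [Fintype.card_piFinset, Finset.prod_const, Finset.card_univ, Fintype.card_coe,
    Finset.card_empty, pow_zero, one_smul]

end terms

end UStat

theorem theorem1
    (B : Type w) [NormedAddCommGroup B] [NormedSpace ℝ B] [CompleteSpace B]
    [TopologicalSpace.SeparableSpace B] [MeasurableSpace B] [BorelSpace B]
    (m : ℕ) (hm : 1 ≤ m) (r : ℝ) (hr : r ∈ Set.Ioc (1 : ℝ) 2) (hB : UStat.IsSmoothSpace r B)
    (p : ℝ) (hp : p ∈ Set.Ioc 1 r) (q : ℝ) (hq : 0 < q) :
    ∃ K : ℝ≥0,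
      ∀ (Ω : Type u) [MeasurableSpace Ω] (P : Measure Ω) [IsProbabilityMeasure P]
        (S : Type v) [MeasurableSpace S] (ξ : ℕ → Ω → S) (_ : UStat.IsIID ξ P)
        (h : (Fin m → ℕ) → (Fin m → S) → B)
        (_ : ∀ i, StrictMono i → Measurable (h i))
        (_ : ∀ i, StrictMono i → UStat.IsDegenerate (h i) ξ P)
        (N : ℕ) (t : ℝ) (_ : 0 < t),
        P {ω | t < (((Finset.Icc m N).sup fun n => ‖UStat.uStat h ξ n ω‖₊ : ℝ≥0) : ℝ)} ≤
          K * ∑ i ∈ UStat.inc m N,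
              UStat.tailIntegral P q t (fun ω => ‖h i (UStat.firstTerms m ξ ω)‖ₑ)
          + K * ∑ J : Finset (Fin m) with J.Nonempty ∧ J ≠ Finset.univ, ∑' a : J → ℕ,
              UStat.tailIntegral P q t (UStat.condMomentRoot P h ξ p N J a)
          + K * (ENNReal.ofReal t ^ (-q) *
              (∑ i ∈ UStat.inc m N, ∫⁻ ω, ‖h i (UStat.firstTerms m ξ ω)‖ₑ ^ p ∂P) ^ (q / p)) := by
  have : SecondCountableTopology B := UniformSpace.secondCountable_of_separable B
  have hp1 : 1 ≤ p := hp.1.le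
  have hp0 : 0 < p := by linarith
  have hκ : 0 < q / p := by positivity
  obtain ⟨ψ, C, hψ⟩ := hB.exists_two_point hr.2 hp
  obtain ⟨K, hK⟩ := UStat.exists_lintegral_trunc_maxStat_le.{v} hp1 hψ hκ m
  set D : ℝ≥0∞ := K * ((2 ^ m * (m + 1) ^ m : ℕ) : ℝ≥0∞) ^ (q / p) with hD
  have hDtop : D * (1 + ENNReal.ofReal q) ≠ ∞ := by
    refine ENNReal.mul_ne_top (ENNReal.mul_ne_top ENNReal.coe_ne_top ?_) (by simp)
    exact ENNReal.rpow_ne_top_of_nonneg hκ.le (ENNReal.natCast_ne_top _)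
  -- The factor `q` of the layer-cake formula enters for nonempty `J`; the summand `1` covers `J =
  -- ∅`.
  refine ⟨(D * (1 + ENNReal.ofReal q)).toNNReal,
    fun Ω _ P _ S _ ξ hξ h hh hd N t ht => ?_⟩
  rw [ENNReal.coe_toNNReal hDtop]
  have hμ := hξ.isProbabilityMeasure_map
  set L : Finset (Fin m) → ℝ≥0∞ := fun J =>
    ∑ a ∈ Fintype.piFinset fun _ : J => Finset.range N, ∫⁻ z, UStat.trunc (q / p)
      (‖t⁻¹‖ₑ ^ p * UStat.condSum (P.map (ξ 0)) p h N J a z) ∂UStat.iidLaw J (P.map (ξ 0)) with hL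
  have h1 : P {ω | t < (((Finset.Icc m N).sup fun n => ‖UStat.uStat h ξ n ω‖₊ : ℝ≥0) : ℝ)} ≤
      D * ∑ J, L J := by
    refine (UStat.measure_lt_sup_uStat_le (κ := q / p) hξ hh hp0 ht N).trans ?_
    refine (hK S _ _ _ _ N (UStat.isDegenerateFamily_kernelFamily hξ hh hd t⁻¹ N)).trans ?_
    rw [hD, mul_assoc]
    gcongr
    exact UStat.sum_lintegral_trunc_condVar_le hp0 hκ hh
  -- Because `m ≥ 1`, the two extreme sets of positions are distinct and can be split off
  -- separately.
  have hne : (∅ : Finset (Fin m)) ≠ Finset.univ := by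
    have : (⟨0, hm⟩ : Fin m) ∈ Finset.univ := Finset.mem_univ _
    exact (Finset.ne_empty_of_mem this).symm
  have h2 : ∑ J, L J = L Finset.univ +
      ∑ J : Finset (Fin m) with J.Nonempty ∧ J ≠ Finset.univ, L J + L ∅ := by
    rw [← Finset.sum_filter_add_sum_filter_not Finset.univ
      (fun J : Finset (Fin m) => J.Nonempty ∧ J ≠ Finset.univ)]
    have h3 : (Finset.univ.filter fun J : Finset (Fin m) => ¬(J.Nonempty ∧ J ≠ Finset.univ)) =
        {Finset.univ, ∅} := by
      ext J
      simp only [Finset.mem_filter, Finset.mem_univ, true_and, Finset.mem_insert,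
        Finset.mem_singleton, Finset.nonempty_iff_ne_empty]
      tauto
    rw [h3, Finset.sum_pair hne.symm]
    ring
  have h4 : ∑ J : Finset (Fin m) with J.Nonempty ∧ J ≠ Finset.univ, L J ≤
      ENNReal.ofReal q * ∑ J : Finset (Fin m) with J.Nonempty ∧ J ≠ Finset.univ, ∑' a : J → ℕ,
        UStat.tailIntegral P q t (UStat.condMomentRoot P h ξ p N J a) := by
    rw [Finset.mul_sum]
    refine Finset.sum_le_sum fun J _ => ?_
    simp only [hL, UStat.lintegral_trunc_condSum_eq hξ hh hp0 hq ht]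
    rw [← Finset.mul_sum]
    gcongr
    exact ENNReal.sum_le_tsum _
  have h5 := UStat.sum_lintegral_trunc_condSum_univ_le (N := N) hξ hh hp0 hq ht
  have h6 := UStat.sum_lintegral_trunc_condSum_empty_le (N := N) hξ hh hp0 hq ht
  refine h1.trans ?_
  rw [h2, mul_add, mul_add, mul_assoc D, mul_assoc D, mul_assoc D]
  gcongr
  · exact h5.trans (by gcongr; exact le_add_self)
  · exact h4.trans (by gcongr; exact le_add_self)
  · exact h6.trans (le_mul_of_one_le_left zero_le le_self_add)
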